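/- **Notation.** For $\omega\in\mathbb R^3$ let $\hat\omega\in\mathrm{so}(3)$ be the matrix with $\hat\omega\xi=\omega\times\xi$. Let $\mathcal B=\{(b_1,b_2)\in\mathbb R^2: b_1>b_2>b_1^{-1/2}\}$ (with $b_1>0$), $b_3:=(b_1b_2)^{-1}$, $\alpha(b)=\mathrm{diag}(b_1,b_2,b_3)$, $\mathcal A=\alpha(\mathcal B)$ and $\mathcal Q=\mathcal A\times SO(3)\times SO(3)$. For a real constant $g$ and $a_1,a_2,a_3>0$ put $$\mathcal V(a)=-2\pi g\int_0^\infty[(s+a_1^2)(s+a_2^2)(s+a_3^2)]^{-1/2}ds,$$ and, for $A=\mathrm{diag}(a_1,a_2,a_3)$, $\mathcal V'(A)=\mathrm{diag}(\partial\mathcal V/\partial a_1,\partial\mathcal V/\partial a_2,\partial\mathcal V/\partial a_3)$; write $\mathcal V(b)=\mathcal V(b_1,b_2,b_3)$. Let $\mathbb P_F[G]=G-\frac13\mathrm{tr}(GF^T)F^{-T}$. *Riemann's equation* for a twice differentiable curve $(A,U_l,U_r)$ in $\mathcal Q$ is, with $\Omega_l=U_l^T\dot U_l$ and $\Omega_r=U_r^T\dot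 U_r$, $$\mathbb P_A\big[\ddot A+2(\Omega_l\dot A-\dot A\Omega_r)+(\dot\Omega_lA-A\dot\Omega_r)+(\Omega_l^2A-2\Omega_lA\Omega_r+A\Omega_r^2)+\mathcal V'(A)\big]=0.$$ Let $\mathcal M=\mathcal B\times\mathbb R^2\times SO(3)^2\times(\mathbb R^3)^2$, with points $(b,c,U,m)$, $U=(U_l,U_r)$, $m=(m_l,m_r)$; scalar and vector products on $(\mathbb R^3)^2$ are $(\omega_l,\omega_r)\cdot(\xi_l,\xi_r)=\omega_l\cdot\xi_l+\omega_r\cdot\xi_r$ and $(\omega_l,\omega_r)\times(\xi_l,\xi_r)=(\omega_l\times\xi_l,\omega_r\times\xi_r)$. The left-trivialized vector $(v,w,\omega,n)\in\mathbb R^2\times\mathbb R^2\times(\mathbb R^3)^2\times(\mathbb R^3)^2$ denotes the tangent vector $(v,w,(U_l\hat\omega_l,U_r\hat\omega_r),n)\in T_{(b,c,U,m)}\mathcal M$. Define $$H(b,c,U,m)=\tfrac12\,c\cdot\mathbb K(b)c+\tfrac12\,m\cdot\mathbb J(b)m+\mathcal V(b),$$ $$\mathbb K(b)=\frac1{b_2^2b_3^2+b_1^2b_3^2+b_1^2b_2^2}\begin{pmatrix}b_1^2(b_2^2+b_3^2)&-b_3\\-b_3&b_2^2(b_1^2+b_3^2)\end{pmatrix},\qquad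 \mathbb J(b)=\begin{pmatrix}J_1(b)&J_2(b)\\J_2(b)&J_1(b)\end{pmatrix},$$ $$J_1(b)=\mathrm{diag}\Big(\tfrac{b_2^2+b_3^2}{(b_2^2-b_3^2)^2},\tfrac{b_1^2+b_3^2}{(b_1^2-b_3^2)^2},\tfrac{b_1^2+b_2^2}{(b_1^2-b_2^2)^2}\Big),\qquad J_2(b)=\mathrm{diag}\Big(\tfrac{2b_2b_3}{(b_2^2-b_3^2)^2},\tfrac{2b_1b_3}{(b_1^2-b_3^2)^2},\tfrac{2b_1b_2}{(b_1^2-b_2^2)^2}\Big),$$ $$\sigma(b,c,U,m)\big((v,w,\omega,n),(v',w',\omega',n')\big)=v\cdot w'-v'\cdot w+\omega\cdot n'-n\cdot\omega'+m\cdot(\omega\times\omega').$$ **Proposition.** The integral defining $\mathcal V$ converges and $\mathcal V$ is smooth for $a_1,a_2,a_3>0$; $\mathcal B$ is open; $\mathcal M$ is a smooth manifold of dimension $16$ with the tangent spaces just described; $H$ is smooth; and $\sigma$ is a symplectic form on $\mathcal M$. There is a diffeomorphism $\mathcal M\to T^*\mathcal Q$ which maps $(b,c,U,m)$ to the covector $(\alpha'(b)v,U_l\hat\omega_l,U_r\hat\omega_r)\mapsto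 c\cdot v+m\cdot\omega$ at $(\alpha(b),U_l,U_r)$, and it pulls back the canonical symplectic form $-d\theta$ of $T^*\mathcal Q$ ($\theta$ the tautological one-form) to $\sigma$. Riemann's equation on $\mathcal Q$ is equivalent to the Hamiltonian system $(\mathcal M,H,\sigma)$ (the vector field $X_H$ with $\sigma(X_H,\cdot)=dH$) in the following sense. The map $$\Lambda:\mathcal M\to T\mathcal Q,\qquad (b,c,U,m)\mapsto\big((\alpha(b),U_l,U_r),\ (\alpha'(b)\mathbb K(b)c,\ U_l\hat\omega_l,\ U_r\hat\omega_r)\big),\quad \omega=\mathbb J(b)m,$$ is a diffeomorphism, and for every open $I\subseteq\mathbb R$: if $\gamma:I\to\mathcal M$ is a solution of the Hamiltonian system, then its projection $q=(\alpha(b),U_l,U_r)$ is a solution of Riemann's equation and $\Lambda\circ\gamma=(q,\dot q)$; conversely, if $q:I\to\mathcal Q$ is a solution of Riemann's equation, then there is a solution $\gamma$ of the Hamiltonian system with $\Lambda\circ\gamma=(q,\dot q)$. -/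

import Mathlib

open scoped Matrix ContDiff

attribute [local instance] Matrix.frobeniusNormedAddCommGroup Matrix.frobeniusNormedSpace

noncomputable section

namespace RiemannEllipsoid

/-! ### Submanifolds of normed spaces, diffeomorphisms, tangent vectors, two-forms -/

section General

variable {E F : Type*} [NormedAddCommGroup E] [NormedSpace ℝ E]
  [NormedAddCommGroup F] [NormedSpace ℝ F]

/-- A map is smooth on a subset `S` of a normed space if, near every point of `S`, it agrees on `S`
with a smooth map that is defined on an open set of the ambient space. -/
def SmoothOn (f : E → F) (S : Set E) : Prop :=
  ∀ p ∈ S, ∃ O : Set E, IsOpen O ∧ p ∈ O ∧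
    ∃ h : E → F, ContDiffOn ℝ ∞ h O ∧ Set.EqOn f h (S ∩ O)

/-- `f` restricts to a diffeomorphism from the subset `S` onto the subset `T`. -/
def IsDiffeo (f : E → F) (S : Set E) (T : Set F) : Prop :=
  Set.MapsTo f S T ∧ SmoothOn f S ∧
    ∃ h : F → E, Set.MapsTo h T S ∧ SmoothOn h T ∧ Set.LeftInvOn h f S ∧ Set.RightInvOn h f T

/-- `S` is a smooth `d`-dimensional submanifold of the normed space `E`: it is locally
diffeomorphic to open subsets of `ℝ^d`. -/
def IsSubmanifold (d : ℕ) (S : Set E) : Prop :=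
  ∀ p ∈ S, ∃ O : Set E, IsOpen O ∧ p ∈ O ∧ ∃ W : Set (Fin d → ℝ), IsOpen W ∧
    ∃ (φ : (Fin d → ℝ) → E) (ψ : E → (Fin d → ℝ)),
      ContDiffOn ℝ ∞ φ W ∧ ContDiffOn ℝ ∞ ψ O ∧
      Set.MapsTo φ W (S ∩ O) ∧ Set.MapsTo ψ (S ∩ O) W ∧
      Set.LeftInvOn ψ φ W ∧ Set.RightInvOn ψ φ (S ∩ O)

/-- Tangent vectors to `S` at `p`: velocities at `p` of curves in `S`. -/
def tangentAt (S : Set E) (p : E) : Set E :=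
  {X | ∃ γ : ℝ → E, (∀ᶠ t in nhds (0 : ℝ), γ t ∈ S) ∧ γ 0 = p ∧ HasDerivAt γ X 0}

/-- The tangent bundle `TS`, as a subset of `E × E`. -/
def tangentBundle (S : Set E) : Set (E × E) :=
  {z | z.1 ∈ S ∧ z.2 ∈ tangentAt S z.1}

/-- Pull-back of a one-form `β` by a map `φ` from `ℝ^d`. -/
def pullback₁ {d : ℕ} (β : E → E → ℝ) (φ : (Fin d → ℝ) → E) (x u : Fin d → ℝ) : ℝ :=
  β (φ x) (fderiv ℝ φ x u)

/-- Pull-back of a two-form `σ` by a map `φ` from `ℝ^d`. -/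
def pullback₂ {d : ℕ} (σ : E → E → E → ℝ) (φ : (Fin d → ℝ) → E) (x u v : Fin d → ℝ) : ℝ :=
  σ (φ x) (fderiv ℝ φ x u) (fderiv ℝ φ x v)

/-- Exterior derivative `dβ(u, v)` of a one-form on (an open subset of) `ℝ^d`. -/
def extD₁ {d : ℕ} (β : (Fin d → ℝ) → (Fin d → ℝ) → ℝ) (x u v : Fin d → ℝ) : ℝ :=
  fderiv ℝ (fun y => β y v) x u - fderiv ℝ (fun y => β y u) x v

/-- Exterior derivative `dτ(u, v, w)` of a two-form on (an open subset of) `ℝ^d`. -/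
def extD₂ {d : ℕ} (τ : (Fin d → ℝ) → (Fin d → ℝ) → (Fin d → ℝ) → ℝ)
    (x u v w : Fin d → ℝ) : ℝ :=
  fderiv ℝ (fun y => τ y v w) x u + fderiv ℝ (fun y => τ y w u) x v
    + fderiv ℝ (fun y => τ y u v) x w

/-- `σ p X Y` (`p ∈ S`, `X, Y ∈ T_p S`) is a symplectic form on the `d`-dimensional submanifold
`S`: bilinear, antisymmetric, nondegenerate, smooth and closed.  The last two conditions are
expressed in local parametrizations `φ` of `S` (more generally, for smooth maps into `S`). -/
def IsSymplecticForm (d : ℕ) (S : Set E) (σ : E → E → E → ℝ) : Prop :=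
  (∀ p ∈ S, ∀ X ∈ tangentAt S p, ∀ Y ∈ tangentAt S p, ∀ Z ∈ tangentAt S p, ∀ r : ℝ,
    σ p (r • X + Y) Z = r * σ p X Z + σ p Y Z) ∧
  (∀ p ∈ S, ∀ X ∈ tangentAt S p, ∀ Y ∈ tangentAt S p, σ p X Y = - σ p Y X) ∧
  (∀ p ∈ S, ∀ X ∈ tangentAt S p, (∀ Y ∈ tangentAt S p, σ p X Y = 0) → X = 0) ∧
  (∀ (W : Set (Fin d → ℝ)) (φ : (Fin d → ℝ) → E), IsOpen W → ContDiffOn ℝ ∞ φ W →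
    Set.MapsTo φ W S →
      (∀ u v, ContDiffOn ℝ ∞ (fun x => pullback₂ σ φ x u v) W) ∧
      (∀ x ∈ W, ∀ u v w, extD₂ (pullback₂ σ φ) x u v w = 0))

/-- `γ` is, on `I`, a solution of the Hamiltonian system `(S, H, σ)`, i.e. an integral curve of the
vector field `X_H` on `S` with `σ(X_H, Y) = dH(Y)` for all tangent vectors `Y`.
`H` is given on a neighbourhood of `S` in the ambient space. -/
def IsHamiltonianSolution (S : Set E) (H : E → ℝ) (σ : E → E → E → ℝ)
    (I : Set ℝ) (γ : ℝ → E) : Prop :=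
  ∀ t ∈ I, γ t ∈ S ∧ DifferentiableAt ℝ γ t ∧
    ∀ Y ∈ tangentAt S (γ t), σ (γ t) (deriv γ t) Y = fderiv ℝ H (γ t) Y

end General

/-! ### Notation for `ℝ³`, `so(3)`, `SO(3)` -/

/-- `ℝ²`, with coordinates numbered `0, 1`. -/
abbrev V2 : Type := Fin 2 → ℝ

/-- `ℝ³`, with coordinates numbered `0, 1, 2`. -/
abbrev V3 : Type := Fin 3 → ℝ

/-- The space `L(3)` of real `3 × 3` matrices. -/
abbrev Mat3 : Type := Matrix (Fin 3) (Fin 3) ℝ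

/-- The rotation group, as a subset of `L(3)`. -/
def SO3 : Set Mat3 := {U | U ∈ Matrix.specialOrthogonalGroup (Fin 3) ℝ}

/-- The isomorphism `ℝ³ → so(3)`. -/
def hat (om : V3) : Mat3 :=
  !![0, -om 2, om 1; om 2, 0, -om 0; -om 1, om 0, 0]

theorem hat_mulVec (om ξ : V3) : hat om *ᵥ ξ = om ⨯₃ ξ := by
  ext i
  fin_cases i <;>
    simp [hat, Matrix.mulVec, dotProduct, Fin.sum_univ_three, cross_apply] <;> ring

/-- The inverse of `hat` on `so(3)`. -/
def vee (X : Mat3) : V3 := ![X 2 1, X 0 2, X 1 0]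

theorem vee_hat (om : V3) : vee (hat om) = om := by
  ext i
  fin_cases i <;> simp [hat, vee]

/-! ### Riemann's equation -/

/-- The self-gravitational potential `𝒱(a)`, with gravitational constant `g`. -/
def potential (g : ℝ) (a : V3) : ℝ :=
  -2 * Real.pi * g * ∫ s in Set.Ioi (0 : ℝ),
    ((s + a 0 ^ 2) * (s + a 1 ^ 2) * (s + a 2 ^ 2)) ^ (-(1 / 2) : ℝ)

/-- `𝒱'(A) = diag(∂𝒱/∂a₁, ∂𝒱/∂a₂, ∂𝒱/∂a₃)` at a diagonal matrix `A = diag(a₁, a₂, a₃)`. -/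
def potentialDeriv (g : ℝ) (A : Mat3) : Mat3 :=
  Matrix.diagonal fun i => fderiv ℝ (potential g) A.diag (Pi.single i 1)

/-- The projection `ℙ_F G = G - ⅓ ⟨G, F⟩ F^{-T}`, where `⟨G, F⟩ = tr (G Fᵀ)`. -/
def proj (F G : Mat3) : Mat3 := G - ((1 / 3 : ℝ) * (G * Fᵀ).trace) • (F⁻¹)ᵀ

/-- The set `ℬ` of all `(b₁, b₂)` with `b₁ > b₂ > b₁^{-1/2}`. -/
def setB : Set V2 := {b | 0 < b 0 ∧ b 1 < b 0 ∧ b 0 ^ (-(1 / 2) : ℝ) < b 1}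

/-- `b₃ = (b₁ b₂)⁻¹`. -/
def b₃ (b : V2) : ℝ := (b 0 * b 1)⁻¹

/-- `α(b) = diag(b₁, b₂, (b₁ b₂)⁻¹)`. -/
def alpha (b : V2) : Mat3 := Matrix.diagonal ![b 0, b 1, b₃ b]

/-- The set `𝒜` of diagonal matrices `diag(a₁, a₂, (a₁ a₂)⁻¹)` with `a₁ > a₂ > a₁^{-1/2}`. -/
def setA : Set Mat3 := alpha '' setB

/-- The space `L(3)³` that contains the configuration space. -/
abbrev ConfSpace : Type := Mat3 × Mat3 × Mat3

/-- The configuration space `𝒜 × SO(3) × SO(3)`; its points are `(A, U_l, U_r)`. -/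
def Conf : Set ConfSpace := {q | q.1 ∈ setA ∧ q.2.1 ∈ SO3 ∧ q.2.2 ∈ SO3}

/-- `t ↦ Uᵀ(t) U̇(t)`. -/
def leftVelocity (U : ℝ → Mat3) (t : ℝ) : Mat3 := (U t)ᵀ * deriv U t

/-- The expression in square brackets in Riemann's equation,
`Ä + 2(Ω_l Ȧ - Ȧ Ω_r) + (Ω̇_l A - A Ω̇_r) + (Ω_l² A - 2 Ω_l A Ω_r + A Ω_r²) + 𝒱'(A)`. -/
def riemannBracket (g : ℝ) (A Ul Ur : ℝ → Mat3) (t : ℝ) : Mat3 :=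
  deriv (deriv A) t
    + (2 : ℝ) • (leftVelocity Ul t * deriv A t - deriv A t * leftVelocity Ur t)
    + (deriv (leftVelocity Ul) t * A t - A t * deriv (leftVelocity Ur) t)
    + (leftVelocity Ul t ^ 2 * A t - (2 : ℝ) • (leftVelocity Ul t * A t * leftVelocity Ur t)
        + A t * leftVelocity Ur t ^ 2)
    + potentialDeriv g (A t)

/-- The curve `q(t) = (A(t), U_l(t), U_r(t))` in the configuration space is, on the open set `I`,
a twice differentiable solution of Riemann's equation. -/
def IsRiemannSolution (g : ℝ) (I : Set ℝ) (q : ℝ → ConfSpace) : Prop :=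
  ∀ t ∈ I, q t ∈ Conf ∧ DifferentiableAt ℝ q t ∧ DifferentiableAt ℝ (deriv q) t ∧
    proj (q t).1 (riemannBracket g (fun s => (q s).1) (fun s => (q s).2.1) (fun s => (q s).2.2) t)
      = 0

/-! ### The phase space, the Hamiltonian and the symplectic form -/

/-- The space `ℝ² × ℝ² × L(3)² × (ℝ³)²` that contains the phase space. -/
abbrev PhaseSpace : Type := V2 × V2 × (Mat3 × Mat3) × (V3 × V3)

/-- The phase space `ℳ = ℬ × ℝ² × SO(3)² × (ℝ³)²`; its points are `(b, c, (U_l, U_r), (m_l, m_r))`. -/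
def phaseM : Set PhaseSpace := {p | p.1 ∈ setB ∧ p.2.2.1.1 ∈ SO3 ∧ p.2.2.1.2 ∈ SO3}

/-- Left-trivialized tangent vectors `(v, w, (ω_l, ω_r), (n_l, n_r))`. -/
abbrev TrivTangent : Type := V2 × V2 × (V3 × V3) × (V3 × V3)

/-- The tangent vector `(v, w, (U_l ω̂_l, U_r ω̂_r), n)` at `p` represented by `(v, w, ω, n)`. -/
def lift (p : PhaseSpace) (ξ : TrivTangent) : PhaseSpace :=
  (ξ.1, ξ.2.1, (p.2.2.1.1 * hat ξ.2.2.1.1, p.2.2.1.2 * hat ξ.2.2.1.2), ξ.2.2.2)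

/-- The inverse of `lift p` on tangent vectors: `ω̂ = Uᵀ (U ω̂)`. -/
def triv (p : PhaseSpace) (X : PhaseSpace) : TrivTangent :=
  (X.1, X.2.1, (vee (p.2.2.1.1ᵀ * X.2.2.1.1), vee (p.2.2.1.2ᵀ * X.2.2.1.2)), X.2.2.2)

/-- Scalar product on `(ℝ³)²`. -/
def dot2 (x y : V3 × V3) : ℝ := x.1 ⬝ᵥ y.1 + x.2 ⬝ᵥ y.2

/-- Vector product on `(ℝ³)²`. -/
def cross2 (x y : V3 × V3) : V3 × V3 := (x.1 ⨯₃ y.1, x.2 ⨯₃ y.2)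

/-- `σ((v, w, ω, n), (v', w', ω', n')) = v·w' - v'·w + ω·n' - n·ω' + m·(ω × ω')`. -/
def sigmaTriv (p : PhaseSpace) (ξ η : TrivTangent) : ℝ :=
  ξ.1 ⬝ᵥ η.2.1 - η.1 ⬝ᵥ ξ.2.1 + dot2 ξ.2.2.1 η.2.2.2 - dot2 ξ.2.2.2 η.2.2.1
    + dot2 p.2.2.2 (cross2 ξ.2.2.1 η.2.2.1)

/-- The two-form `σ` evaluated on (untrivialized) tangent vectors to `ℳ`. -/
def sigma (p X Y : PhaseSpace) : ℝ := sigmaTriv p (triv p X) (triv p Y)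

/-- The matrix `𝕂(b)`. -/
def matK (b : V2) : Matrix (Fin 2) (Fin 2) ℝ :=
  (1 / (b 1 ^ 2 * b₃ b ^ 2 + b 0 ^ 2 * b₃ b ^ 2 + b 0 ^ 2 * b 1 ^ 2)) •
    !![b 0 ^ 2 * (b 1 ^ 2 + b₃ b ^ 2), -b₃ b;
       -b₃ b, b 1 ^ 2 * (b 0 ^ 2 + b₃ b ^ 2)]

/-- The diagonal matrix `J₁(b)`. -/
def matJ₁ (b : V2) : Mat3 :=
  Matrix.diagonal ![(b 1 ^ 2 + b₃ b ^ 2) / (b 1 ^ 2 - b₃ b ^ 2) ^ 2,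
    (b 0 ^ 2 + b₃ b ^ 2) / (b 0 ^ 2 - b₃ b ^ 2) ^ 2,
    (b 0 ^ 2 + b 1 ^ 2) / (b 0 ^ 2 - b 1 ^ 2) ^ 2]

/-- The diagonal matrix `J₂(b)`. -/
def matJ₂ (b : V2) : Mat3 :=
  Matrix.diagonal ![2 * b 1 * b₃ b / (b 1 ^ 2 - b₃ b ^ 2) ^ 2,
    2 * b 0 * b₃ b / (b 0 ^ 2 - b₃ b ^ 2) ^ 2,
    2 * b 0 * b 1 / (b 0 ^ 2 - b 1 ^ 2) ^ 2]

/-- The `6 × 6` matrix `𝕁(b)`. -/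
def matJ (b : V2) : Matrix (Fin 3 ⊕ Fin 3) (Fin 3 ⊕ Fin 3) ℝ :=
  Matrix.fromBlocks (matJ₁ b) (matJ₂ b) (matJ₂ b) (matJ₁ b)

/-- `𝕁(b) m`, as an element of `(ℝ³)²`. -/
def applyJ (b : V2) (m : V3 × V3) : V3 × V3 :=
  (fun i => (matJ b *ᵥ Sum.elim m.1 m.2) (Sum.inl i),
   fun i => (matJ b *ᵥ Sum.elim m.1 m.2) (Sum.inr i))

/-- `H(b, c, U, m) = ½ c·𝕂(b)c + ½ m·𝕁(b)m + 𝒱(b)`. -/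
def hamiltonian (g : ℝ) (p : PhaseSpace) : ℝ :=
  (1 / 2) * (p.2.1 ⬝ᵥ (matK p.1 *ᵥ p.2.1)) + (1 / 2) * dot2 p.2.2.2 (applyJ p.1 p.2.2.2)
    + potential g ![p.1 0, p.1 1, b₃ p.1]

/-! ### Relation with the configuration space -/

/-- The projection `(b, c, U, m) ↦ (α(b), U_l, U_r)` onto the configuration space. -/
def config (p : PhaseSpace) : ConfSpace := (alpha p.1, p.2.2.1.1, p.2.2.1.2)

/-- The tangent vector `(α'(b)v, U_l ω̂_l, U_r ω̂_r)` to the configuration space at `config p`. -/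
def configTangent (p : PhaseSpace) (v : V2) (om : V3 × V3) : ConfSpace :=
  (fderiv ℝ alpha p.1 v, p.2.2.1.1 * hat om.1, p.2.2.1.2 * hat om.2)

/-- The map from `ℳ` to `T(𝒜 × SO(3) × SO(3))` with velocities `ḃ = 𝕂(b)c`, `ω = 𝕁(b)m`. -/
def toTangent (p : PhaseSpace) : ConfSpace × ConfSpace :=
  (config p, configTangent p (matK p.1 *ᵥ p.2.1) (applyJ p.1 p.2.2.2))

/-- The inner product on `L(3)³` by which covectors on the configuration space are represented as
tangent vectors: the trace inner product on `𝒜`, half of it on each factor `SO(3)`. -/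
def pairing (x y : ConfSpace) : ℝ :=
  (x.1 * y.1ᵀ).trace + (1 / 2) * (x.2.1 * y.2.1ᵀ).trace + (1 / 2) * (x.2.2 * y.2.2ᵀ).trace

/-- The cotangent bundle `T*(𝒜 × SO(3) × SO(3))`: the point `(q, π)`, with `π ∈ T_q`, stands for
the covector `pairing π · ` on `T_q`. -/
def cotangentBundle : Set (ConfSpace × ConfSpace) := tangentBundle Conf

/-- The canonical (tautological) one-form of the cotangent bundle, `θ_{(q,π)}(δq, δπ) = π(δq)`. -/
def tautological (z ζ : ConfSpace × ConfSpace) : ℝ := pairing z.2 ζ.1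

end RiemannEllipsoid

end

open RiemannEllipsoid

/-!
The idea is the Legendre transformation in left-trivialized coordinates.

Motions `F = U_l A U_rᵀ` have the kinetic energy `½ |Ȧ|² + ½ |ω̂_l A - A ω̂_r|²`.  In terms of
`b` and `ω` this is the quadratic form with the matrices `gram` and `inertia`, whose inverses are
`𝕂` and `𝕁` (`gram_matK_mulVec`, `inertia_applyJ`); `𝕁` exists because `b₁ > b₂ > b₃` on `ℬ`.  As
both matrices and their inverses are smooth, the maps `(b, c, U, m) ↦ (α(b), U; α'(b) 𝕂(b) c, U
ω̂)` with `ω = 𝕁(b) m` or `ω = m` are diffeomorphisms onto the (co)tangent bundle of the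
configuration space (`isDiffeo_bundleMap`).  Charts of `SO(3)` are obtained from the Cayley
transform, which is rational with a rational inverse.

The tautological form becomes `θ = c·db + m·ω`.  Differentiating `ω̂ = Uᵀ U̇` once more produces
the commutator of `ω̂` and `ω̂'`, so that `σ = -dθ` (`pullback_sigma`), and closedness of `σ` is
`d² = 0`.

The equation `σ(X, ·) = dH` amounts to `ḃ = 𝕂c`, `ω = 𝕁m`, `ċ = -∂H/∂b`, `ṁ = m × ω`
(`hamilton_iff`). To avoid differentiating `𝕂` and `𝕁`, the derivative of `H` along a curve is
computed by duality: the variation of `½ c·𝕂(b)c` with `b` is minus that of `½ v·gram(b)v` at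
fixed `v = 𝕂(b)c`, and likewise for `𝕁`.  The first two equations say that `Λ ∘ γ = (q, q̇)`.
Given these, let `R` be the bracket in Riemann's equation.  The components of `ṁ - m × ω` are
invertible linear combinations of the off-diagonal entries of `R` (`momentum_eq_cross_iff`), and
`ċ = -∂H/∂b` says that the diagonal of `R` is orthogonal to the tangent space of `𝒜`, i.e. a
multiple of the diagonal of `A⁻¹` (`forall_axesDeriv_dotProduct_iff`).  Together this is `ℙ_A R =
0` (`proj_diagonal_eq_zero_iff`).

The potential is, up to a factor, the function `x ↦ ∫ ∏ᵢ (s + xᵢ)^(-1/2) ds` at `xᵢ = aᵢ²`.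
Partial derivatives of `∫ ∏ᵢ (s + xᵢ)^(-pᵢ) ds` are again of this form, with larger exponents,
which proves smoothness by induction (`contDiffOn_integral_shiftProd`).
-/

namespace RiemannEllipsoid

/-! ### Smoothness of the self-gravitational potential -/

section Potential

open MeasureTheory Set

variable {ι : Type*} [Fintype ι]

/-- The integrand `∏ᵢ (s + xᵢ)^(-pᵢ)`.  With general exponents the class of such integrands is
closed under differentiation in `x`. -/
noncomputable def shiftProd (p x : ι → ℝ) (s : ℝ) : ℝ := ∏ i, (s + x i) ^ (-p i)

theorem continuousOn_shiftProd (p : ι → ℝ) {x : ι → ℝ} (hx : ∀ i, 0 < x i) :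
    ContinuousOn (shiftProd p x) (Ioi 0) := by
  refine continuousOn_finsetProd _ fun i _ => ?_
  refine ContinuousOn.rpow_const (by fun_prop) fun s hs => Or.inl ?_
  have := hx i
  simp only [mem_Ioi] at hs
  positivity

theorem shiftProd_nonneg (p : ι → ℝ) {x : ι → ℝ} (hx : ∀ i, 0 < x i) {s : ℝ} (hs : 0 < s) :
    0 ≤ shiftProd p x s :=
  Finset.prod_nonneg fun i _ => Real.rpow_nonneg (by have := hx i; positivity) _

theorem shiftProd_le {p : ι → ℝ} (hp : ∀ i, 0 ≤ p i) {x : ι → ℝ} {δ : ℝ} (hδ : 0 < δ)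
    (hx : ∀ i, δ ≤ x i) {s : ℝ} (hs : 0 < s) :
    shiftProd p x s ≤ (s + δ) ^ (-∑ i, p i) := by
  rw [← Finset.sum_neg_distrib, Real.rpow_sum_of_pos (by positivity)]
  refine Finset.prod_le_prod (fun i _ => Real.rpow_nonneg ?_ _) fun i _ => ?_
  · linarith [hx i]
  · exact Real.rpow_le_rpow_of_nonpos (by positivity) (by linarith [hx i]) (by linarith [hp i])

theorem exists_pos_forall_lt {x : ι → ℝ} (hx : ∀ i, 0 < x i) : ∃ δ > 0, ∀ i, δ < x i := by
  rcases isEmpty_or_nonempty ι with h | h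
  · exact ⟨1, one_pos, fun i => h.elim i⟩
  · obtain ⟨i, hi⟩ := Finite.exists_min x
    exact ⟨x i / 2, by linarith [hx i], fun j => by linarith [hi j, hx i]⟩

theorem integrableOn_shiftProd {p : ι → ℝ} (hp : ∀ i, 0 ≤ p i) (hp1 : 1 < ∑ i, p i) {x : ι → ℝ}
    (hx : ∀ i, 0 < x i) : IntegrableOn (shiftProd p x) (Ioi 0) := by
  obtain ⟨δ, hδ, hle⟩ := exists_pos_forall_lt hx
  refine Integrable.mono' (integrableOn_add_rpow_Ioi_of_lt (a := -∑ i, p i) (m := δ) (by linarith)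
    (by linarith)) ((continuousOn_shiftProd p hx).aestronglyMeasurable measurableSet_Ioi) ?_
  refine (ae_restrict_iff' measurableSet_Ioi).2 (.of_forall fun s hs => ?_)
  rw [Real.norm_of_nonneg (shiftProd_nonneg p hx hs)]
  exact shiftProd_le hp hδ (fun i => (hle i).le) hs

theorem hasFDerivAt_shiftProd [DecidableEq ι] (p : ι → ℝ) {x : ι → ℝ} (hx : ∀ i, 0 < x i) {s : ℝ}
    (hs : 0 < s) :
    HasFDerivAt (fun y => shiftProd p y s)
      (∑ i, (-p i * shiftProd (p + Pi.single i 1) x s) •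
        ContinuousLinearMap.proj (R := ℝ) (φ := fun _ : ι => ℝ) i) x := by
  have hpos : ∀ i, 0 < s + x i := fun i => by have := hx i; positivity
  have h := HasFDerivAt.finsetProd (u := Finset.univ) (x := x)
    (g := fun i (y : ι → ℝ) => (s + y i) ^ (-p i))
    (fun i _ => ((hasFDerivAt_apply (𝕜 := ℝ) i x).const_add s).rpow_const
      (p := -p i) (Or.inl (hpos i).ne'))
  refine h.congr_fderiv (Finset.sum_congr rfl fun i _ => ?_)
  rw [smul_smul]
  congr 1
  rw [shiftProd, ← Finset.mul_prod_erase _ _ (Finset.mem_univ i)]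
  have : ∏ j ∈ Finset.univ.erase i, (s + x j) ^ (-(p + Pi.single i 1 : ι → ℝ) j)
      = ∏ j ∈ Finset.univ.erase i, (s + x j) ^ (-p j) :=
    Finset.prod_congr rfl fun j hj => by simp [Finset.ne_of_mem_erase hj]
  rw [this]
  simp only [Pi.add_apply, Pi.single_eq_same]
  rw [neg_add, ← sub_eq_add_neg]
  ring

/-- Differentiation under the integral sign: on the neighbourhood `{y | ∀ i, δ < yᵢ}` of `x` the
derivative of the integrand is dominated by a multiple of `(s + δ)^(-∑ pᵢ - 1)`. -/
theorem hasFDerivAt_integral_shiftProd [DecidableEq ι] {p : ι → ℝ} (hp : ∀ i, 0 ≤ p i)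
    (hp1 : 1 < ∑ i, p i) {x : ι → ℝ} (hx : ∀ i, 0 < x i) :
    HasFDerivAt (fun y => ∫ s in Ioi (0 : ℝ), shiftProd p y s)
      (∑ i, (-p i * ∫ s in Ioi (0 : ℝ), shiftProd (p + Pi.single i 1) x s) •
        ContinuousLinearMap.proj (R := ℝ) (φ := fun _ : ι => ℝ) i) x := by
  have hp' : ∀ i j, 0 ≤ (p + Pi.single i 1 : ι → ℝ) j := fun i j =>
    add_nonneg (hp j) (by by_cases h : j = i <;> simp [h])
  have hsum : ∀ i, ∑ j, (p + Pi.single i 1 : ι → ℝ) j = ∑ j, p j + 1 := fun i => by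
    simp [Finset.sum_add_distrib]
  have hint : ∀ i, IntegrableOn (shiftProd (p + Pi.single i 1) x) (Ioi 0) := fun i =>
    integrableOn_shiftProd (hp' i) (by rw [hsum]; linarith) hx
  obtain ⟨δ, hδ, hle⟩ := exists_pos_forall_lt hx
  have hopen : IsOpen {y : ι → ℝ | ∀ i, δ < y i} := by
    simp only [ofPred_forall]
    exact isOpen_iInter_of_finite fun i => isOpen_lt continuous_const (continuous_apply i)
  have hnhds := hopen.mem_nhds (show x ∈ {y : ι → ℝ | ∀ i, δ < y i} from hle)
  have key := hasFDerivAt_integral_of_dominated_of_fderiv_le (𝕜 := ℝ)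
    (μ := volume.restrict (Ioi (0 : ℝ))) (x₀ := x)
    (F := fun y s => shiftProd p y s)
    (F' := fun y s => ∑ i, (-p i * shiftProd (p + Pi.single i 1) y s) •
        ContinuousLinearMap.proj (R := ℝ) (φ := fun _ : ι => ℝ) i)
    (bound := fun s => ∑ i, (p i * (s + δ) ^ (-(∑ j, p j + 1))) *
      ‖ContinuousLinearMap.proj (R := ℝ) (φ := fun _ : ι => ℝ) i‖)
    hnhds ?_ (integrableOn_shiftProd hp hp1 hx) ?_ ?_ ?_ ?_
  · refine key.congr_fderiv ?_
    rw [integral_finsetSum]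
    · refine Finset.sum_congr rfl fun i _ => ?_
      rw [integral_smul_const, integral_const_mul]
    · exact fun i _ => ((hint i).const_mul _).smul_const _
  · filter_upwards [hnhds] with y hy
    exact (continuousOn_shiftProd p fun i => hδ.trans (hy i)).aestronglyMeasurable
      measurableSet_Ioi
  · refine ContinuousOn.aestronglyMeasurable (continuousOn_finsetSum _ fun i _ => ?_)
      measurableSet_Ioi
    exact ((continuousOn_shiftProd _ hx).const_mul _).smul continuousOn_const
  · refine (ae_restrict_iff' measurableSet_Ioi).2 (.of_forall fun s hs y hy => ?_)
    refine norm_sum_le_of_le _ fun i _ => ?_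
    rw [norm_smul, norm_mul, norm_neg, Real.norm_of_nonneg (hp i), Real.norm_of_nonneg
      (shiftProd_nonneg _ (fun i => hδ.trans (hy i)) hs), ← hsum i]
    gcongr
    · exact hp i
    · exact shiftProd_le (hp' i) hδ (fun i => (hy i).le) hs
  · refine integrable_finsetSum _ fun i _ => Integrable.mul_const (Integrable.const_mul ?_ _) _
    exact integrableOn_add_rpow_Ioi_of_lt (by linarith) (by linarith)
  · exact (ae_restrict_iff' measurableSet_Ioi).2 (.of_forall fun s hs y hy =>
      hasFDerivAt_shiftProd p (fun i => hδ.trans (hy i)) hs)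

theorem isOpen_forall_pos : IsOpen {x : ι → ℝ | ∀ i, 0 < x i} := by
  simp only [ofPred_forall]
  exact isOpen_iInter_of_finite fun i => isOpen_lt continuous_const (continuous_apply i)

/-- Induction on the order of differentiability: the partial derivatives of such an integral are
integrals of the same kind with larger exponents. -/
theorem contDiffOn_integral_shiftProd (n : ℕ) {p : ι → ℝ} (hp : ∀ i, 0 ≤ p i)
    (hp1 : 1 < ∑ i, p i) :
    ContDiffOn ℝ n (fun y => ∫ s in Ioi (0 : ℝ), shiftProd p y s) {x : ι → ℝ | ∀ i, 0 < x i} := by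
  classical
  induction n generalizing p with
  | zero =>
    exact contDiffOn_zero.2 fun x hx =>
      (hasFDerivAt_integral_shiftProd hp hp1 hx).continuousAt.continuousWithinAt
  | succ n ih =>
    push_cast
    rw [contDiffOn_succ_iff_fderiv_of_isOpen isOpen_forall_pos]
    refine ⟨fun x hx => (hasFDerivAt_integral_shiftProd hp hp1 hx).differentiableAt
      |>.differentiableWithinAt, by simp, ?_⟩
    refine ContDiffOn.congr (f := fun x => ∑ i, (-p i * ∫ s in Ioi (0 : ℝ),
      shiftProd (p + Pi.single i 1) x s) •
        ContinuousLinearMap.proj (R := ℝ) (φ := fun _ : ι => ℝ) i)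
      ?_ fun x hx => (hasFDerivAt_integral_shiftProd hp hp1 hx).fderiv
    refine ContDiffOn.sum fun i _ => ContDiffOn.smul (contDiffOn_const.mul (ih ?_ ?_))
      contDiffOn_const
    · exact fun j => add_nonneg (hp j) (by by_cases h : j = i <;> simp [h])
    · simp only [Pi.add_apply, Finset.sum_add_distrib, Finset.sum_pi_single', Finset.mem_univ,
        if_true]
      simp
      linarith

theorem potential_integrand_eq (a : V3) {s : ℝ} (hs : 0 < s) :
    ((s + a 0 ^ 2) * (s + a 1 ^ 2) * (s + a 2 ^ 2)) ^ (-(1 / 2) : ℝ)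
      = shiftProd (fun _ => 1 / 2) (fun i => a i ^ 2) s := by
  rw [shiftProd, Fin.prod_univ_three, Real.mul_rpow, Real.mul_rpow] <;> positivity

theorem integrableOn_potential {a : V3} (ha : ∀ i, 0 < a i) : IntegrableOn
    (fun s : ℝ => ((s + a 0 ^ 2) * (s + a 1 ^ 2) * (s + a 2 ^ 2)) ^ (-(1 / 2) : ℝ)) (Ioi 0) := by
  refine IntegrableOn.congr_fun (f := shiftProd (fun _ => 1 / 2) (fun i => a i ^ 2)) ?_
    (fun s hs => (potential_integrand_eq a hs).symm) measurableSet_Ioi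
  exact integrableOn_shiftProd (by norm_num) (by norm_num) fun i => pow_pos (ha i) 2

theorem contDiffOn_potential (g : ℝ) : ContDiffOn ℝ ∞ (potential g) {a | ∀ i, 0 < a i} := by
  have h : ContDiffOn ℝ ∞ (fun y : V3 => ∫ s in Ioi (0 : ℝ), shiftProd (fun _ => 1 / 2) y s)
      {x | ∀ i, 0 < x i} :=
    contDiffOn_infty.2 fun n => contDiffOn_integral_shiftProd n (by norm_num) (by norm_num)
  have h2 : ContDiffOn ℝ ∞ (fun a : V3 => fun i => a i ^ 2) {x | ∀ i, 0 < x i} := by fun_prop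
  refine ContDiffOn.congr (contDiffOn_const (c := -2 * Real.pi * g) |>.mul
    (h.comp h2 fun a ha i => pow_pos (ha i) 2)) fun a _ => ?_
  rw [potential]
  congr 1
  exact setIntegral_congr_fun measurableSet_Ioi fun s hs => potential_integrand_eq a hs

end Potential

/-! ### Calculus in `L(3)` -/

section MatrixCalculus

variable {E : Type*} [NormedAddCommGroup E] [NormedSpace ℝ E] {n : WithTop ℕ∞} {S : Set E}
  {f h : E → Mat3}

@[fun_prop]
theorem contDiffOn_mat_mul (hf : ContDiffOn ℝ n f S) (hh : ContDiffOn ℝ n h S) :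
    ContDiffOn ℝ n (fun x => f x * h x) S := by
  let := Matrix.frobeniusNormedRing (m := Fin 3) (α := ℝ)
  let := Matrix.frobeniusNormedAlgebra (m := Fin 3) (R := ℝ) (α := ℝ)
  exact hf.mul hh

theorem hasDerivAt_mat_mul {f h : ℝ → Mat3} {f' h' : Mat3} {t : ℝ} (hf : HasDerivAt f f' t)
    (hh : HasDerivAt h h' t) : HasDerivAt (fun y => f y * h y) (f' * h t + f t * h') t := by
  let := Matrix.frobeniusNormedRing (m := Fin 3) (α := ℝ)
  let := Matrix.frobeniusNormedAlgebra (m := Fin 3) (R := ℝ) (α := ℝ)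
  exact hf.mul hh

/-- Transposition as a continuous linear map. -/
noncomputable def transposeL : Mat3 →L[ℝ] Mat3 :=
  LinearMap.toContinuousLinearMap (Matrix.transposeLinearEquiv (Fin 3) (Fin 3) ℝ ℝ).toLinearMap

/-- The diagonal of a matrix, as a continuous linear map. -/
noncomputable def diagL : Mat3 →L[ℝ] V3 :=
  LinearMap.toContinuousLinearMap (Matrix.diagLinearMap (Fin 3) ℝ ℝ)

/-- The diagonal matrix with given diagonal, as a continuous linear map. -/
noncomputable def diagonalL : V3 →L[ℝ] Mat3 :=
  LinearMap.toContinuousLinearMap (Matrix.diagonalLinearMap (Fin 3) ℝ ℝ)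

/-- The trace as a continuous linear map. -/
noncomputable def traceL : Mat3 →L[ℝ] ℝ :=
  LinearMap.toContinuousLinearMap (Matrix.traceLinearMap (Fin 3) ℝ ℝ)

/-- `hat` as a continuous linear map. -/
noncomputable def hatL : V3 →L[ℝ] Mat3 := LinearMap.toContinuousLinearMap
  { toFun := hat
    map_add' := fun x y => by ext i j; fin_cases i <;> fin_cases j <;> simp [hat] <;> ring
    map_smul' := fun r x => by ext i j; fin_cases i <;> fin_cases j <;> simp [hat] }

/-- `vee` as a continuous linear map. -/
noncomputable def veeL : Mat3 →L[ℝ] V3 := LinearMap.toContinuousLinearMap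
  { toFun := vee
    map_add' := fun x y => by ext i; fin_cases i <;> simp [vee]
    map_smul' := fun r x => by ext i; fin_cases i <;> simp [vee] }

theorem hat_smul (r : ℝ) (x : V3) : hat (r • x) = r • hat x := hatL.map_smul r x

theorem vee_add (x y : Mat3) : vee (x + y) = vee x + vee y := veeL.map_add x y

theorem vee_smul (r : ℝ) (x : Mat3) : vee (r • x) = r • vee x := veeL.map_smul r x

@[fun_prop]
theorem contDiffOn_transpose (hf : ContDiffOn ℝ n f S) : ContDiffOn ℝ n (fun x => (f x)ᵀ) S :=
  transposeL.contDiff.comp_contDiffOn hf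

@[fun_prop]
theorem contDiffOn_diag (hf : ContDiffOn ℝ n f S) : ContDiffOn ℝ n (fun x => (f x).diag) S :=
  diagL.contDiff.comp_contDiffOn hf

@[fun_prop]
theorem contDiffOn_trace (hf : ContDiffOn ℝ n f S) : ContDiffOn ℝ n (fun x => (f x).trace) S :=
  traceL.contDiff.comp_contDiffOn hf

@[fun_prop]
theorem contDiffOn_vee (hf : ContDiffOn ℝ n f S) : ContDiffOn ℝ n (fun x => vee (f x)) S :=
  veeL.contDiff.comp_contDiffOn hf

@[fun_prop]
theorem contDiffOn_hat {f : E → V3} (hf : ContDiffOn ℝ n f S) :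
    ContDiffOn ℝ n (fun x => hat (f x)) S :=
  hatL.contDiff.comp_contDiffOn hf

@[fun_prop]
theorem contDiffOn_diagonal {f : E → V3} (hf : ContDiffOn ℝ n f S) :
    ContDiffOn ℝ n (fun x => Matrix.diagonal (f x) : E → Mat3) S :=
  diagonalL.contDiff.comp_contDiffOn hf

theorem contDiffOn_vec2 {f h : E → ℝ} (hf : ContDiffOn ℝ n f S) (hh : ContDiffOn ℝ n h S) :
    ContDiffOn ℝ n (fun x => (![f x, h x] : V2)) S :=
  contDiffOn_pi.2 fun i => by fin_cases i <;> assumption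

theorem contDiffOn_vec3 {f h k : E → ℝ} (hf : ContDiffOn ℝ n f S) (hh : ContDiffOn ℝ n h S)
    (hk : ContDiffOn ℝ n k S) : ContDiffOn ℝ n (fun x => (![f x, h x, k x] : V3)) S :=
  contDiffOn_pi.2 fun i => by fin_cases i <;> assumption

end MatrixCalculus

/-! ### The rotation group and its Cayley charts -/

theorem mem_SO3_iff {U : Mat3} : U ∈ SO3 ↔ Uᵀ * U = 1 ∧ U.det = 1 := by
  rw [SO3, Set.mem_ofPred_eq, Matrix.mem_specialOrthogonalGroup_iff,
    Matrix.mem_orthogonalGroup_iff']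

theorem SO3_mul_transpose {U : Mat3} (hU : U ∈ SO3) : U * Uᵀ = 1 :=
  mul_eq_one_comm.1 (mem_SO3_iff.1 hU).1

theorem SO3_mul {U R : Mat3} (hU : U ∈ SO3) (hR : R ∈ SO3) : U * R ∈ SO3 :=
  (Matrix.specialOrthogonalGroup (Fin 3) ℝ).mul_mem hU hR

theorem SO3_transpose {U : Mat3} (hU : U ∈ SO3) : Uᵀ ∈ SO3 :=
  mem_SO3_iff.2 ⟨by rw [Matrix.transpose_transpose]; exact SO3_mul_transpose hU,
    by rw [Matrix.det_transpose]; exact (mem_SO3_iff.1 hU).2⟩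

theorem hat_transpose (x : V3) : (hat x)ᵀ = -hat x := by
  ext i j
  fin_cases i <;> fin_cases j <;> simp [hat]

theorem hat_vee {M : Mat3} (hM : Mᵀ = -M) : hat (vee M) = M := by
  have h : ∀ i j, M j i = -M i j := fun i j => congrFun (congrFun hM i) j
  ext i j
  fin_cases i <;> fin_cases j <;> simp [hat, vee] <;>
    linarith [h 0 0, h 1 1, h 2 2, h 0 1, h 1 2, h 0 2]

theorem transpose_mul_mul_hat {U : Mat3} (hU : U ∈ SO3) (x : V3) : Uᵀ * (U * hat x) = hat x := by
  rw [← Matrix.mul_assoc, (mem_SO3_iff.1 hU).1, Matrix.one_mul]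

theorem vee_transpose_mul_mul_hat {U : Mat3} (hU : U ∈ SO3) (x : V3) :
    vee (Uᵀ * (U * hat x)) = x := by
  rw [transpose_mul_mul_hat hU, vee_hat]

/-- The velocity of a curve in `SO(3)` is of the form `U ω̂`. -/
theorem velocity_SO3 {U : ℝ → Mat3} {X : Mat3} {t : ℝ} (hU : ∀ᶠ s in nhds t, U s ∈ SO3)
    (hX : HasDerivAt U X t) : U t * hat (vee ((U t)ᵀ * X)) = X := by
  have hT : HasDerivAt (fun s => (U s)ᵀ) Xᵀ t := transposeL.hasFDerivAt.comp_hasDerivAt t hX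
  have h1 := hasDerivAt_mat_mul hT hX
  have h2 : HasDerivAt (fun s => (U s)ᵀ * U s) 0 t :=
    (hasDerivAt_const t (1 : Mat3)).congr_of_eventuallyEq
      (hU.mono fun s hs => (mem_SO3_iff.1 hs).1)
  have h3 := h1.unique h2
  rw [hat_vee, ← Matrix.mul_assoc, SO3_mul_transpose hU.self_of_nhds, Matrix.one_mul]
  rw [Matrix.transpose_mul, Matrix.transpose_transpose]
  exact eq_neg_of_add_eq_zero_left h3

/-- The Cayley transform `x ↦ (1 - x̂)⁻¹ (1 + x̂)`, in the form given by the Rodrigues formula. -/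
noncomputable def cayley (x : V3) : Mat3 :=
  1 + (2 / (1 + x ⬝ᵥ x)) • (hat x + hat x * hat x)

/-- The inverse of the Cayley transform, defined on rotations by an angle other than `π`. -/
noncomputable def cayleyInv (R : Mat3) : V3 := (1 + R.trace)⁻¹ • vee (R - Rᵀ)

theorem one_add_dot_self_pos (x : V3) : 0 < 1 + x ⬝ᵥ x := by
  have : 0 ≤ x ⬝ᵥ x := Finset.sum_nonneg fun i _ => mul_self_nonneg _
  linarith

theorem cayley_mem (x : V3) : cayley x ∈ SO3 := by
  have hn := (one_add_dot_self_pos x).ne'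
  have hk : 2 / (1 + x ⬝ᵥ x) * (1 + x ⬝ᵥ x) = 2 := div_mul_cancel₀ _ hn
  rw [mem_SO3_iff, cayley]
  generalize 2 / (1 + x ⬝ᵥ x) = k at hk
  simp only [dotProduct, Fin.sum_univ_three] at hk
  constructor
  · ext i j
    fin_cases i <;> fin_cases j <;>
      simp [hat, Matrix.mul_apply, Fin.sum_univ_three]
    · linear_combination k * (x 1 ^ 2 + x 2 ^ 2) * hk
    · linear_combination -k * (x 0 * x 1) * hk
    · linear_combination -k * (x 0 * x 2) * hk
    · linear_combination -k * (x 0 * x 1) * hk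
    · linear_combination k * (x 0 ^ 2 + x 2 ^ 2) * hk
    · linear_combination -k * (x 1 * x 2) * hk
    · linear_combination -k * (x 0 * x 2) * hk
    · linear_combination -k * (x 1 * x 2) * hk
    · linear_combination k * (x 0 ^ 2 + x 1 ^ 2) * hk
  · rw [Matrix.det_fin_three]
    simp [hat]
    linear_combination k * (x 0 ^ 2 + x 1 ^ 2 + x 2 ^ 2) * hk

theorem one_add_trace_cayley (x : V3) : 1 + (cayley x).trace = 4 / (1 + x ⬝ᵥ x) := by
  have hn := (one_add_dot_self_pos x).ne'
  have : (cayley x).trace = 3 - (2 / (1 + x ⬝ᵥ x)) * (2 * (x ⬝ᵥ x)) := by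
    rw [cayley]
    generalize 2 / (1 + x ⬝ᵥ x) = k
    simp [hat, Matrix.trace, Fin.sum_univ_three, dotProduct]
    ring
  rw [this]
  field_simp
  ring

theorem cayleyInv_cayley (x : V3) : cayleyInv (cayley x) = x := by
  have hn := (one_add_dot_self_pos x).ne'
  have : vee (cayley x - (cayley x)ᵀ) = (2 * (2 / (1 + x ⬝ᵥ x))) • x := by
    rw [cayley]
    generalize 2 / (1 + x ⬝ᵥ x) = k
    ext i
    fin_cases i <;>
      simp [hat, vee] <;> ring
  rw [cayleyInv, one_add_trace_cayley, this, smul_smul]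
  have : (4 / (1 + x ⬝ᵥ x))⁻¹ * (2 * (2 / (1 + x ⬝ᵥ x))) = 1 := by
    field_simp
    norm_num
  rw [this, one_smul]

/-- For a rotation, the Cayley-Hamilton theorem reads `R² = t R - t + Rᵀ`, with `t = tr R`. -/
theorem SO3_sq {R : Mat3} (hR : R ∈ SO3) : R * R = R.trace • R - R.trace • 1 + Rᵀ := by
  have hinv : R.adjugate = Rᵀ := by
    have h := Matrix.adjugate_mul R
    rw [(mem_SO3_iff.1 hR).2, one_smul] at h
    calc R.adjugate = R.adjugate * (R * Rᵀ) := by rw [SO3_mul_transpose hR, Matrix.mul_one]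
      _ = Rᵀ := by rw [← Matrix.mul_assoc, h, Matrix.one_mul]
  have h : R * R = R.trace • R - R.adjugate.trace • 1 + R.adjugate := by
    rw [Matrix.adjugate_fin_three]
    ext i j
    fin_cases i <;> fin_cases j <;>
      simp [Matrix.trace, Matrix.mul_apply, Fin.sum_univ_three] <;> ring
  rw [h, hinv, Matrix.trace_transpose]

theorem cayley_cayleyInv {R : Mat3} (hR : R ∈ SO3) (ht : 1 + R.trace ≠ 0) :
    cayley (cayleyInv R) = R := by
  have hhat : hat (cayleyInv R) = (1 + R.trace)⁻¹ • (R - Rᵀ) := by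
    rw [cayleyInv, hat_smul, hat_vee]
    simp
  have hsq : hat (cayleyInv R) * hat (cayleyInv R) = (1 + R.trace)⁻¹ • (R + Rᵀ - (2 : ℝ) • 1) := by
    have h2 := SO3_sq (SO3_transpose hR)
    rw [Matrix.trace_transpose, Matrix.transpose_transpose] at h2
    have h : (R - Rᵀ) * (R - Rᵀ) = (1 + R.trace) • (R + Rᵀ - (2 : ℝ) • 1) := by
      rw [Matrix.sub_mul, Matrix.mul_sub, Matrix.mul_sub, SO3_sq hR, h2, SO3_mul_transpose hR,
        (mem_SO3_iff.1 hR).1]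
      module
    rw [hhat, Matrix.smul_mul, Matrix.mul_smul, h, smul_smul, smul_smul]
    congr 1
    field_simp
  have hdot : ∀ x : V3, x ⬝ᵥ x = -(1 / 2) * (hat x * hat x).trace := fun x => by
    simp [hat, Matrix.trace, Fin.sum_univ_three, dotProduct]
    ring
  have hn : 1 + cayleyInv R ⬝ᵥ cayleyInv R = 4 / (1 + R.trace) := by
    rw [hdot, hsq]
    simp
    field_simp
    ring
  rw [cayley, hn, hsq, hhat, ← smul_add, smul_smul]
  have : 2 / (4 / (1 + R.trace)) * (1 + R.trace)⁻¹ = 1 / 2 := by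
    field_simp
    norm_num
  rw [this]
  module

@[fun_prop]
theorem contDiffOn_cayley {E : Type*} [NormedAddCommGroup E] [NormedSpace ℝ E]
    {n : WithTop ℕ∞} {S : Set E} {f : E → V3} (hf : ContDiffOn ℝ n f S) :
    ContDiffOn ℝ n (fun x => cayley (f x)) S := by
  have h : ContDiffOn ℝ n (fun x => 1 + f x ⬝ᵥ f x) S := by
    simp only [dotProduct]
    fun_prop
  have := contDiffOn_const (c := (2 : ℝ)).div h fun x _ => (one_add_dot_self_pos (f x)).ne'
  exact contDiffOn_const.add (this.smul (by fun_prop))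

theorem hasDerivAt_cayley (x : V3) :
    HasDerivAt (fun t : ℝ => cayley ((t / 2) • x)) (hat x) 0 := by
  have h1 : HasDerivAt (fun t : ℝ => t / (1 + (t / 2) ^ 2 * (x ⬝ᵥ x))) 1 0 := by
    have hd : HasDerivAt (fun t : ℝ => 1 + (t / 2) ^ 2 * (x ⬝ᵥ x)) 0 0 :=
      ((((hasDerivAt_id (0 : ℝ)).div_const 2).pow 2).mul_const (x ⬝ᵥ x)).const_add 1
        |>.congr_deriv (by simp)
    exact ((hasDerivAt_id (0 : ℝ)).div hd (by simp)).congr_deriv (by simp)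
  have h2 : HasDerivAt (fun t : ℝ => t / (1 + (t / 2) ^ 2 * (x ⬝ᵥ x)) * (t / 2)) 0 0 :=
    (h1.mul ((hasDerivAt_id (0 : ℝ)).div_const 2)).congr_deriv (by simp)
  have h3 : (fun t : ℝ => cayley ((t / 2) • x)) = fun t => 1 +
      ((t / (1 + (t / 2) ^ 2 * (x ⬝ᵥ x))) • hat x +
        (t / (1 + (t / 2) ^ 2 * (x ⬝ᵥ x)) * (t / 2)) • (hat x * hat x)) := by
    ext1 t
    rw [cayley, hat_smul, Matrix.smul_mul, Matrix.mul_smul, smul_add, smul_smul, smul_smul,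
      smul_smul, smul_dotProduct, dotProduct_smul]
    simp only [smul_eq_mul]
    congr 3 <;> ring
  rw [h3]
  exact (((h1.smul_const (hat x)).add (h2.smul_const (hat x * hat x))).const_add
    (1 : Mat3)).congr_deriv (by rw [one_smul, zero_smul, add_zero])

/-! ### The set `ℬ` and the principal axes -/

theorem mem_setB_iff {b : V2} : b ∈ setB ↔ 0 < b 0 ∧ b 1 < b 0 ∧ 0 < b 1 ∧ 1 < b 0 * b 1 ^ 2 := by
  rw [setB, Set.mem_ofPred_eq]
  refine and_congr_right fun h0 => and_congr_right fun _ => ?_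
  have hpos : 0 < b 0 ^ (-(1 / 2) : ℝ) := Real.rpow_pos_of_pos h0 _
  have hsq : (b 0 ^ (-(1 / 2) : ℝ)) ^ 2 = (b 0)⁻¹ := by
    rw [← Real.rpow_natCast, ← Real.rpow_mul h0.le]
    norm_num
    exact Real.rpow_neg_one _
  have hiff : 1 < b 0 * b 1 ^ 2 ↔ (b 0 ^ (-(1 / 2) : ℝ)) ^ 2 < b 1 ^ 2 := by
    rw [hsq, inv_lt_iff_one_lt_mul₀' h0]
  rw [hiff]
  constructor
  · exact fun h => ⟨hpos.trans h, pow_lt_pow_left₀ h hpos.le two_ne_zero⟩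
  · exact fun h => lt_of_pow_lt_pow_left₀ 2 h.1.le h.2

theorem isOpen_setB : IsOpen setB := by
  have : setB = {b : V2 | 0 < b 0} ∩
      ({b | b 1 < b 0} ∩ ({b | 0 < b 1} ∩ {b | 1 < b 0 * b 1 ^ 2})) :=
    Set.ext fun b => mem_setB_iff
  rw [this]
  refine (isOpen_lt ?_ ?_).inter ((isOpen_lt ?_ ?_).inter ((isOpen_lt ?_ ?_).inter
    (isOpen_lt ?_ ?_))) <;> fun_prop

section Axes

variable {b : V2}

theorem b0_pos (hb : b ∈ setB) : 0 < b 0 := (mem_setB_iff.1 hb).1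

theorem b1_pos (hb : b ∈ setB) : 0 < b 1 := (mem_setB_iff.1 hb).2.2.1

theorem b₃_pos (hb : b ∈ setB) : 0 < b₃ b := inv_pos.2 (mul_pos (b0_pos hb) (b1_pos hb))

theorem b1_lt_b0 (hb : b ∈ setB) : b 1 < b 0 := (mem_setB_iff.1 hb).2.1

theorem b₃_lt_b1 (hb : b ∈ setB) : b₃ b < b 1 := by
  have h0 := b0_pos hb
  have h1 := b1_pos hb
  rw [b₃, inv_lt_iff_one_lt_mul₀' (mul_pos h0 h1)]
  linarith [(mem_setB_iff.1 hb).2.2.2, show b 0 * b 1 * b 1 = b 0 * b 1 ^ 2 by ring]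

/-- The principal axes `(b₁, b₂, b₃)`. -/
noncomputable def axes (b : V2) : V3 := ![b 0, b 1, b₃ b]

theorem alpha_eq (b : V2) : alpha b = Matrix.diagonal (axes b) := rfl

theorem axes_pos (hb : b ∈ setB) : ∀ i, 0 < axes b i := by
  intro i
  fin_cases i
  exacts [b0_pos hb, b1_pos hb, b₃_pos hb]

theorem axes_sq_sub_pos (hb : b ∈ setB) : 0 < b 1 ^ 2 - b₃ b ^ 2 ∧ 0 < b 0 ^ 2 - b₃ b ^ 2 ∧
    0 < b 0 ^ 2 - b 1 ^ 2 := by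
  have h1 := b1_lt_b0 hb
  have h2 := b₃_lt_b1 hb
  have h3 := b₃_pos hb
  refine ⟨?_, ?_, ?_⟩ <;> nlinarith

theorem contDiffOn_b₃ : ContDiffOn ℝ ∞ b₃ {b | b 0 * b 1 ≠ 0} := by
  unfold b₃
  fun_prop (disch := aesop)

theorem contDiffOn_axes : ContDiffOn ℝ ∞ axes {b | b 0 * b 1 ≠ 0} :=
  contDiffOn_vec3 (by fun_prop) (by fun_prop) contDiffOn_b₃

theorem contDiffOn_alpha : ContDiffOn ℝ ∞ alpha {b | b 0 * b 1 ≠ 0} :=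
  contDiffOn_diagonal contDiffOn_axes

theorem isOpen_mul_ne_zero : IsOpen {b : V2 | b 0 * b 1 ≠ 0} :=
  isOpen_ne_fun (by fun_prop) (by fun_prop)

theorem mul_ne_zero_of_mem (hb : b ∈ setB) : b 0 * b 1 ≠ 0 := (mul_pos (b0_pos hb) (b1_pos hb)).ne'

/-- The velocity of the principal axes when `b` moves with velocity `v`. -/
noncomputable def axesDeriv (b v : V2) : V3 :=
  ![v 0, v 1, -(b₃ b * (v 0 / b 0 + v 1 / b 1))]

theorem hasFDerivAt_axes (hb : b 0 * b 1 ≠ 0) :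
    ∃ D : V2 →L[ℝ] V3, HasFDerivAt axes D b ∧ ∀ v, D v = axesDeriv b v := by
  have h0 : b 0 ≠ 0 := left_ne_zero_of_mul hb
  have h1 : b 1 ≠ 0 := right_ne_zero_of_mul hb
  have hp : ∀ i : Fin 2, HasFDerivAt (fun x : V2 => x i)
      (ContinuousLinearMap.proj (R := ℝ) (φ := fun _ : Fin 2 => ℝ) i) b :=
    fun i => hasFDerivAt_apply i b
  have hd := (contDiffOn_axes.contDiffAt (isOpen_mul_ne_zero.mem_nhds hb)).differentiableAt
    (by simp)
  have h3 : HasFDerivAt b₃ _ b := (hasDerivAt_inv hb).comp_hasFDerivAt b ((hp 0).mul (hp 1))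
  have hi := hasFDerivAt_pi'.1 hd.hasFDerivAt
  refine ⟨_, hd.hasFDerivAt, fun v => ?_⟩
  ext i
  fin_cases i
  · exact DFunLike.congr_fun ((hi 0).unique (hp 0)) v
  · exact DFunLike.congr_fun ((hi 1).unique (hp 1)) v
  · refine (DFunLike.congr_fun ((hi 2).unique h3) v).trans ?_
    simp [axesDeriv, b₃]
    field_simp
    ring

theorem fderiv_alpha (hb : b 0 * b 1 ≠ 0) (v : V2) :
    fderiv ℝ alpha b v = Matrix.diagonal (axesDeriv b v) := by
  obtain ⟨D, hD, hv⟩ := hasFDerivAt_axes hb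
  have h : HasFDerivAt alpha (diagonalL.comp D) b := diagonalL.hasFDerivAt.comp b hD
  rw [h.fderiv, ← hv]
  rfl

theorem hasDerivAt_axes {β : ℝ → V2} {v : V2} {t : ℝ} (hβ : HasDerivAt β v t)
    (hb : β t 0 * β t 1 ≠ 0) : HasDerivAt (fun s => axes (β s)) (axesDeriv (β t) v) t := by
  obtain ⟨D, hD, hv⟩ := hasFDerivAt_axes hb
  rw [← hv]
  exact hD.comp_hasDerivAt t hβ

theorem hasDerivAt_alpha {β : ℝ → V2} {v : V2} {t : ℝ} (hβ : HasDerivAt β v t)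
    (hb : β t 0 * β t 1 ≠ 0) : HasDerivAt (fun s => alpha (β s)) (fderiv ℝ alpha (β t) v) t := by
  rw [fderiv_alpha hb]
  exact diagonalL.hasFDerivAt.comp_hasDerivAt t (hasDerivAt_axes hβ hb)

/-- The first two diagonal entries of a matrix; on `𝒜` this is the inverse of `alpha`. -/
noncomputable def firstTwo (A : Mat3) : V2 := ![A.diag 0, A.diag 1]

theorem firstTwo_alpha (b : V2) : firstTwo (alpha b) = b := by
  ext i
  fin_cases i <;> simp [firstTwo, alpha]

theorem firstTwo_fderiv_alpha (hb : b 0 * b 1 ≠ 0) (v : V2) :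
    firstTwo (fderiv ℝ alpha b v) = v := by
  rw [fderiv_alpha hb]
  ext i
  fin_cases i <;> simp [firstTwo, axesDeriv]

@[fun_prop]
theorem contDiffOn_firstTwo {E : Type*} [NormedAddCommGroup E] [NormedSpace ℝ E]
    {n : WithTop ℕ∞} {S : Set E} {f : E → Mat3} (hf : ContDiffOn ℝ n f S) :
    ContDiffOn ℝ n (fun x => firstTwo (f x)) S :=
  contDiffOn_vec2 (by fun_prop) (by fun_prop)

theorem hasDerivAt_firstTwo {A : ℝ → Mat3} {X : Mat3} {t : ℝ} (hA : HasDerivAt A X t) :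
    HasDerivAt (fun s => firstTwo (A s)) (firstTwo X) t := by
  have h : HasDerivAt (fun s => (A s).diag) X.diag t := diagL.hasFDerivAt.comp_hasDerivAt t hA
  rw [hasDerivAt_pi] at h ⊢
  intro i
  fin_cases i
  exacts [h 0, h 1]

theorem mem_setA_iff {A : Mat3} : A ∈ setA ↔ firstTwo A ∈ setB ∧ alpha (firstTwo A) = A := by
  constructor
  · rintro ⟨b, hb, rfl⟩
    rw [firstTwo_alpha]
    exact ⟨hb, rfl⟩
  · exact fun h => ⟨_, h.1, h.2⟩

end Axes

/-! ### Tangent spaces of the phase space and of the configuration space -/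

theorem config_mem {p : PhaseSpace} (hp : p ∈ phaseM) : config p ∈ Conf :=
  ⟨⟨_, hp.1, rfl⟩, hp.2⟩

theorem exists_curve_SO3 {U : Mat3} (hU : U ∈ SO3) (x : V3) : ∃ γ : ℝ → Mat3,
    (∀ t, γ t ∈ SO3) ∧ γ 0 = U ∧ HasDerivAt γ (U * hat x) 0 := by
  refine ⟨fun t => U * cayley ((t / 2) • x), fun t => SO3_mul hU (cayley_mem _), ?_, ?_⟩
  · have h0 : hat 0 = 0 := hatL.map_zero
    simp [cayley, h0]
  · exact (hasDerivAt_mat_mul (hasDerivAt_const 0 U) (hasDerivAt_cayley x)).congr_deriv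
      (by rw [Matrix.zero_mul, zero_add])

/-- The base curve through `b` with velocity `v`. -/
theorem exists_curve_setB {b : V2} (hb : b ∈ setB) (v : V2) : ∃ β : ℝ → V2,
    (∀ᶠ t in nhds 0, β t ∈ setB) ∧ β 0 = b ∧ HasDerivAt β v 0 := by
  have hd : HasDerivAt (fun t : ℝ => b + t • v) v 0 := by
    simpa using ((hasDerivAt_id (0 : ℝ)).smul_const v).const_add b
  refine ⟨_, ?_, by simp, hd⟩
  exact hd.continuousAt.eventually_mem (isOpen_setB.mem_nhds (by simpa using hb))

theorem lift_mem_tangentAt {p : PhaseSpace} (hp : p ∈ phaseM) (ξ : TrivTangent) :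
    lift p ξ ∈ tangentAt phaseM p := by
  obtain ⟨β, hβ, hβ0, hβd⟩ := exists_curve_setB hp.1 ξ.1
  obtain ⟨γl, hl, hl0, hld⟩ := exists_curve_SO3 hp.2.1 ξ.2.2.1.1
  obtain ⟨γr, hr, hr0, hrd⟩ := exists_curve_SO3 hp.2.2 ξ.2.2.1.2
  have hc : HasDerivAt (fun t : ℝ => p.2.1 + t • ξ.2.1) ξ.2.1 0 := by
    simpa using ((hasDerivAt_id (0 : ℝ)).smul_const ξ.2.1).const_add p.2.1
  have hm : HasDerivAt (fun t : ℝ => p.2.2.2 + t • ξ.2.2.2) ξ.2.2.2 0 := by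
    simpa using ((hasDerivAt_id (0 : ℝ)).smul_const ξ.2.2.2).const_add p.2.2.2
  refine ⟨_, hβ.mono fun t ht => ⟨ht, hl t, hr t⟩, ?_, hβd.prodMk (hc.prodMk
    ((hld.prodMk hrd).prodMk hm))⟩
  simp [hβ0, hl0, hr0]

theorem triv_lift {p : PhaseSpace} (hp : p ∈ phaseM) (ξ : TrivTangent) :
    triv p (lift p ξ) = ξ := by
  simp only [triv, lift, vee_transpose_mul_mul_hat hp.2.1, vee_transpose_mul_mul_hat hp.2.2]

theorem lift_triv {p X : PhaseSpace} (hX : X ∈ tangentAt phaseM p) : lift p (triv p X) = X := by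
  obtain ⟨γ, hγ, rfl, hd⟩ := hX
  have hU : HasDerivAt (fun t => (γ t).2.2.1) X.2.2.1 0 :=
    ((ContinuousLinearMap.fst ℝ (Mat3 × Mat3) (V3 × V3)).comp
      ((ContinuousLinearMap.snd ℝ V2 _).comp (ContinuousLinearMap.snd ℝ V2 _))
        ).hasFDerivAt.comp_hasDerivAt 0 hd
  have hl := velocity_SO3 (hγ.mono fun t ht => ht.2.1) hU.fst
  have hr := velocity_SO3 (hγ.mono fun t ht => ht.2.2) hU.snd
  simp only [lift, triv, hl, hr]

theorem lift_bijOn {p : PhaseSpace} (hp : p ∈ phaseM) :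
    Set.BijOn (lift p) Set.univ (tangentAt phaseM p) :=
  ⟨fun ξ _ => lift_mem_tangentAt hp ξ,
    fun ξ _ η _ h => by rw [← triv_lift hp ξ, h, triv_lift hp η],
    fun X hX => ⟨triv p X, trivial, lift_triv hX⟩⟩

theorem configTangent_mem_tangentAt {p : PhaseSpace} (hp : p ∈ phaseM) (v : V2) (om : V3 × V3) :
    configTangent p v om ∈ tangentAt Conf (config p) := by
  obtain ⟨β, hβ, hβ0, hβd⟩ := exists_curve_setB hp.1 v
  obtain ⟨γl, hl, hl0, hld⟩ := exists_curve_SO3 hp.2.1 om.1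
  obtain ⟨γr, hr, hr0, hrd⟩ := exists_curve_SO3 hp.2.2 om.2
  have hα := hasDerivAt_alpha hβd (by rw [hβ0]; exact mul_ne_zero_of_mem hp.1)
  rw [hβ0] at hα
  refine ⟨_, hβ.mono fun t ht => ⟨⟨_, ht, rfl⟩, hl t, hr t⟩, ?_, hα.prodMk (hld.prodMk hrd)⟩
  simp [hβ0, hl0, hr0, config]

/-- Tangent vectors to the configuration space, in terms of a phase point above the base point. -/
theorem configTangent_of_mem {p : PhaseSpace} (hp : p ∈ phaseM) {X : ConfSpace}
    (hX : X ∈ tangentAt Conf (config p)) :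
    configTangent p (firstTwo X.1) (vee (p.2.2.1.1ᵀ * X.2.1), vee (p.2.2.1.2ᵀ * X.2.2)) = X := by
  obtain ⟨γ, hγ, h0, hd⟩ := hX
  have hl := velocity_SO3 (hγ.mono fun t ht => ht.2.1) hd.snd.fst
  have hr := velocity_SO3 (hγ.mono fun t ht => ht.2.2) hd.snd.snd
  have hd1 : HasDerivAt (fun t => (γ t).1) X.1 0 := hd.fst
  have hb := hasDerivAt_firstTwo hd1
  have hb0 : firstTwo (γ 0).1 = p.1 := by rw [h0]; exact firstTwo_alpha p.1
  have hα := hasDerivAt_alpha hb (by rw [hb0]; exact mul_ne_zero_of_mem hp.1)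
  have hA : fderiv ℝ alpha p.1 (firstTwo X.1) = X.1 := by
    rw [← hb0]
    exact hα.unique (hd1.congr_of_eventuallyEq (hγ.mono fun t ht => (mem_setA_iff.1 ht.1).2))
  rw [h0] at hl hr
  exact Prod.ext hA (Prod.ext hl hr)

/-! ### The phase space is a submanifold -/

theorem isSubmanifold_phaseM : IsSubmanifold 16 phaseM := by
  intro p hp
  let e : (Fin 16 → ℝ) ≃L[ℝ] TrivTangent :=
    ContinuousLinearEquiv.ofFinrankEq (by simp [TrivTangent])
  have hUl := (mem_SO3_iff.1 hp.2.1).1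
  have hUr := (mem_SO3_iff.1 hp.2.2).1
  have hO : ∀ U : Mat3, IsOpen {R : Mat3 | 1 + (Uᵀ * R).trace ≠ 0} := fun U =>
    isOpen_ne_fun (continuous_const.add
      (traceL.continuous.comp (Continuous.matrix_mul continuous_const continuous_id)))
      continuous_const
  have he : ContDiff ℝ ∞ e := e.contDiff
  have hes : ContDiff ℝ ∞ e.symm := e.symm.contDiff
  refine ⟨{q | 1 + (p.2.2.1.1ᵀ * q.2.2.1.1).trace ≠ 0 ∧ 1 + (p.2.2.1.2ᵀ * q.2.2.1.2).trace ≠ 0},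
    ?_, ?_, {x | (e x).1 ∈ setB}, isOpen_setB.preimage (by fun_prop),
    fun x => ((e x).1, (e x).2.1, (p.2.2.1.1 * cayley (e x).2.2.1.1,
      p.2.2.1.2 * cayley (e x).2.2.1.2), (e x).2.2.2),
    fun q => e.symm (q.1, q.2.1, (cayleyInv (p.2.2.1.1ᵀ * q.2.2.1.1),
      cayleyInv (p.2.2.1.2ᵀ * q.2.2.1.2)), q.2.2.2), ?_, ?_, ?_, ?_, ?_, ?_⟩
  · exact ((hO p.2.2.1.1).preimage (by fun_prop : Continuous fun q : PhaseSpace => q.2.2.1.1)).inter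
      ((hO p.2.2.1.2).preimage (by fun_prop : Continuous fun q : PhaseSpace => q.2.2.1.2))
  · simp only [Set.mem_ofPred_eq, hUl, hUr, Matrix.trace_one]
    norm_num
  · fun_prop
  · refine hes.comp_contDiffOn ?_
    unfold cayleyInv
    have h1 : ContDiffOn ℝ ∞ (fun q : PhaseSpace => (1 + (p.2.2.1.1ᵀ * q.2.2.1.1).trace)⁻¹)
      {q | 1 + (p.2.2.1.1ᵀ * q.2.2.1.1).trace ≠ 0 ∧ 1 + (p.2.2.1.2ᵀ * q.2.2.1.2).trace ≠ 0} :=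
      ContDiffOn.inv (by fun_prop) fun q hq => hq.1
    have h2 : ContDiffOn ℝ ∞ (fun q : PhaseSpace => (1 + (p.2.2.1.2ᵀ * q.2.2.1.2).trace)⁻¹)
      {q | 1 + (p.2.2.1.1ᵀ * q.2.2.1.1).trace ≠ 0 ∧ 1 + (p.2.2.1.2ᵀ * q.2.2.1.2).trace ≠ 0} :=
      ContDiffOn.inv (by fun_prop) fun q hq => hq.2
    fun_prop
  · intro x hx
    refine ⟨⟨hx, SO3_mul hp.2.1 (cayley_mem _), SO3_mul hp.2.2 (cayley_mem _)⟩, ?_⟩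
    simp only [Set.mem_ofPred_eq, ← Matrix.mul_assoc, hUl, hUr, Matrix.one_mul,
      one_add_trace_cayley]
    exact ⟨(div_pos four_pos (one_add_dot_self_pos _)).ne',
      (div_pos four_pos (one_add_dot_self_pos _)).ne'⟩
  · intro q hq
    simpa using hq.1.1
  · intro x _
    simp only [← Matrix.mul_assoc, hUl, hUr, Matrix.one_mul, cayleyInv_cayley, Prod.mk.eta,
      ContinuousLinearEquiv.symm_apply_apply]
  · intro q hq
    simp only [ContinuousLinearEquiv.apply_symm_apply]
    rw [cayley_cayleyInv (SO3_mul (SO3_transpose hp.2.1) hq.1.2.1) hq.2.1,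
      cayley_cayleyInv (SO3_mul (SO3_transpose hp.2.2) hq.1.2.2) hq.2.2,
      ← Matrix.mul_assoc, ← Matrix.mul_assoc, SO3_mul_transpose hp.2.1, SO3_mul_transpose hp.2.2,
      Matrix.one_mul, Matrix.one_mul]

/-! ### Velocities and momenta -/

section Legendre

variable {b : V2}

/-- The Gram matrix `α'(b)ᵀ α'(b)` of the metric on `𝒜`, applied to a velocity. -/
noncomputable def gram (b v : V2) : V2 :=
  ![v 0 - b₃ b / b 0 * axesDeriv b v 2, v 1 - b₃ b / b 1 * axesDeriv b v 2]

/-- The map from angular velocities to angular momenta for an ellipsoid with axes `a`. -/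
noncomputable def inertiaOf (a : V3) (om : V3 × V3) : V3 × V3 :=
  (![(a 1 ^ 2 + a 2 ^ 2) * om.1 0 - 2 * a 1 * a 2 * om.2 0,
     (a 0 ^ 2 + a 2 ^ 2) * om.1 1 - 2 * a 0 * a 2 * om.2 1,
     (a 0 ^ 2 + a 1 ^ 2) * om.1 2 - 2 * a 0 * a 1 * om.2 2],
   ![(a 1 ^ 2 + a 2 ^ 2) * om.2 0 - 2 * a 1 * a 2 * om.1 0,
     (a 0 ^ 2 + a 2 ^ 2) * om.2 1 - 2 * a 0 * a 2 * om.1 1,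
     (a 0 ^ 2 + a 1 ^ 2) * om.2 2 - 2 * a 0 * a 1 * om.1 2])

/-- The inverse of `𝕁(b)`: the map from angular velocities to angular momenta. -/
noncomputable def inertia (b : V2) (om : V3 × V3) : V3 × V3 := inertiaOf (axes b) om

/-- The momentum `c = gram b v` pairs with a velocity `w` as `α'(b)v` pairs with `α'(b)w`. -/
theorem gram_dotProduct (b v w : V2) : gram b v ⬝ᵥ w = axesDeriv b v ⬝ᵥ axesDeriv b w := by
  simp [gram, axesDeriv, dotProduct, Fin.sum_univ_two, Fin.sum_univ_three]
  ring

theorem matK_mulVec (b c : V2) : matK b *ᵥ c =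
    ![(b 0 ^ 2 * (b 1 ^ 2 + b₃ b ^ 2) * c 0 - b₃ b * c 1) /
        (b 1 ^ 2 * b₃ b ^ 2 + b 0 ^ 2 * b₃ b ^ 2 + b 0 ^ 2 * b 1 ^ 2),
      (b 1 ^ 2 * (b 0 ^ 2 + b₃ b ^ 2) * c 1 - b₃ b * c 0) /
        (b 1 ^ 2 * b₃ b ^ 2 + b 0 ^ 2 * b₃ b ^ 2 + b 0 ^ 2 * b 1 ^ 2)] := by
  ext i
  fin_cases i <;> simp [matK, Matrix.mulVec, dotProduct, Fin.sum_univ_two] <;> ring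

theorem applyJ_eq (b : V2) (m : V3 × V3) : applyJ b m =
    (![(b 1 ^ 2 + b₃ b ^ 2) / (b 1 ^ 2 - b₃ b ^ 2) ^ 2 * m.1 0
        + 2 * b 1 * b₃ b / (b 1 ^ 2 - b₃ b ^ 2) ^ 2 * m.2 0,
       (b 0 ^ 2 + b₃ b ^ 2) / (b 0 ^ 2 - b₃ b ^ 2) ^ 2 * m.1 1
        + 2 * b 0 * b₃ b / (b 0 ^ 2 - b₃ b ^ 2) ^ 2 * m.2 1,
       (b 0 ^ 2 + b 1 ^ 2) / (b 0 ^ 2 - b 1 ^ 2) ^ 2 * m.1 2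
        + 2 * b 0 * b 1 / (b 0 ^ 2 - b 1 ^ 2) ^ 2 * m.2 2],
     ![(b 1 ^ 2 + b₃ b ^ 2) / (b 1 ^ 2 - b₃ b ^ 2) ^ 2 * m.2 0
        + 2 * b 1 * b₃ b / (b 1 ^ 2 - b₃ b ^ 2) ^ 2 * m.1 0,
       (b 0 ^ 2 + b₃ b ^ 2) / (b 0 ^ 2 - b₃ b ^ 2) ^ 2 * m.2 1
        + 2 * b 0 * b₃ b / (b 0 ^ 2 - b₃ b ^ 2) ^ 2 * m.1 1,
       (b 0 ^ 2 + b 1 ^ 2) / (b 0 ^ 2 - b 1 ^ 2) ^ 2 * m.2 2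
        + 2 * b 0 * b 1 / (b 0 ^ 2 - b 1 ^ 2) ^ 2 * m.1 2]) := by
  ext i
  · fin_cases i <;>
      simp [applyJ, matJ, matJ₁, matJ₂, Matrix.fromBlocks_mulVec, Matrix.mulVec_diagonal]
  · fin_cases i <;>
      simp [applyJ, matJ, matJ₁, matJ₂, Matrix.fromBlocks_mulVec, Matrix.mulVec_diagonal] <;> ring

theorem matK_denom_pos (hb : b ∈ setB) :
    0 < b 1 ^ 2 * b₃ b ^ 2 + b 0 ^ 2 * b₃ b ^ 2 + b 0 ^ 2 * b 1 ^ 2 := by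
  have := b0_pos hb
  have := b1_pos hb
  have := b₃_pos hb
  positivity

theorem matK_mulVec_gram (hb : b ∈ setB) (v : V2) : matK b *ᵥ gram b v = v := by
  have h0 := b0_pos hb
  have h1 := b1_pos hb
  rw [matK_mulVec]
  ext i
  fin_cases i <;>
  · simp only [gram, axesDeriv, b₃, Matrix.cons_val, Fin.zero_eta, Fin.mk_one]
    rw [div_eq_iff (by positivity)]
    field_simp
    ring

theorem gram_matK_mulVec (hb : b ∈ setB) (c : V2) : gram b (matK b *ᵥ c) = c := by
  have h0 := b0_pos hb
  have h1 := b1_pos hb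
  have hD : b 1 ^ 2 + b 0 ^ 2 + b 0 ^ 4 * b 1 ^ 4 ≠ 0 := by positivity
  rw [matK_mulVec]
  ext i
  fin_cases i <;>
  · simp only [gram, axesDeriv, b₃, Matrix.cons_val, Fin.zero_eta, Fin.mk_one]
    field_simp
    ring

/-- `[[x² + y², 2xy], [2xy, x² + y²]] / (x² - y²)²` is the inverse of
`[[x² + y², -2xy], [-2xy, x² + y²]]`. -/
theorem inertia_apply_inv {x y : ℝ} (h : 0 < x ^ 2 - y ^ 2) (l r : ℝ) :
    (x ^ 2 + y ^ 2) * ((x ^ 2 + y ^ 2) / (x ^ 2 - y ^ 2) ^ 2 * l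
        + 2 * x * y / (x ^ 2 - y ^ 2) ^ 2 * r)
      - 2 * x * y * ((x ^ 2 + y ^ 2) / (x ^ 2 - y ^ 2) ^ 2 * r
        + 2 * x * y / (x ^ 2 - y ^ 2) ^ 2 * l) = l := by
  have := h.ne'
  field_simp
  ring

theorem inertia_inv_apply {x y : ℝ} (h : 0 < x ^ 2 - y ^ 2) (l r : ℝ) :
    (x ^ 2 + y ^ 2) / (x ^ 2 - y ^ 2) ^ 2 * ((x ^ 2 + y ^ 2) * l - 2 * x * y * r)
      + 2 * x * y / (x ^ 2 - y ^ 2) ^ 2 * ((x ^ 2 + y ^ 2) * r - 2 * x * y * l) = l := by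
  have := h.ne'
  field_simp
  ring

theorem inertia_applyJ (hb : b ∈ setB) (m : V3 × V3) : inertia b (applyJ b m) = m := by
  obtain ⟨h1, h2, h3⟩ := axes_sq_sub_pos hb
  rw [applyJ_eq]
  ext i <;> fin_cases i
  exacts [inertia_apply_inv h1 _ _, inertia_apply_inv h2 _ _, inertia_apply_inv h3 _ _,
    inertia_apply_inv h1 _ _, inertia_apply_inv h2 _ _, inertia_apply_inv h3 _ _]

theorem applyJ_inertia (hb : b ∈ setB) (om : V3 × V3) : applyJ b (inertia b om) = om := by
  obtain ⟨h1, h2, h3⟩ := axes_sq_sub_pos hb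
  rw [applyJ_eq]
  ext i <;> fin_cases i
  exacts [inertia_inv_apply h1 _ _, inertia_inv_apply h2 _ _, inertia_inv_apply h3 _ _,
    inertia_inv_apply h1 _ _, inertia_inv_apply h2 _ _, inertia_inv_apply h3 _ _]

end Legendre

section Smoothness

variable {E : Type*} [NormedAddCommGroup E] [NormedSpace ℝ E] {n : WithTop ℕ∞} {S : Set E}

@[fun_prop]
theorem contDiffOn_b₃_comp {f : E → V2} (hf : ContDiffOn ℝ ∞ f S) (h : ∀ x ∈ S, f x ∈ setB) :
    ContDiffOn ℝ ∞ (fun x => b₃ (f x)) S :=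
  contDiffOn_b₃.comp hf fun x hx => mul_ne_zero_of_mem (h x hx)

@[fun_prop]
theorem contDiffOn_axes_comp {f : E → V2} (hf : ContDiffOn ℝ ∞ f S) (h : ∀ x ∈ S, f x ∈ setB) :
    ContDiffOn ℝ ∞ (fun x => axes (f x)) S :=
  contDiffOn_axes.comp hf fun x hx => mul_ne_zero_of_mem (h x hx)

theorem contDiffOn_axesDeriv {f h : E → V2} (hf : ContDiffOn ℝ ∞ f S) (hh : ContDiffOn ℝ ∞ h S)
    (hS : ∀ x ∈ S, f x ∈ setB) : ContDiffOn ℝ ∞ (fun x => axesDeriv (f x) (h x)) S := by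
  have h0 : ∀ x ∈ S, f x 0 ≠ 0 := fun x hx => (b0_pos (hS x hx)).ne'
  have h1 : ∀ x ∈ S, f x 1 ≠ 0 := fun x hx => (b1_pos (hS x hx)).ne'
  refine contDiffOn_vec3 ?_ ?_ ?_ <;> fun_prop (disch := assumption)

theorem contDiffOn_gram {f h : E → V2} (hf : ContDiffOn ℝ ∞ f S) (hh : ContDiffOn ℝ ∞ h S)
    (hS : ∀ x ∈ S, f x ∈ setB) : ContDiffOn ℝ ∞ (fun x => gram (f x) (h x)) S := by
  have h0 : ∀ x ∈ S, f x 0 ≠ 0 := fun x hx => (b0_pos (hS x hx)).ne'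
  have h1 : ∀ x ∈ S, f x 1 ≠ 0 := fun x hx => (b1_pos (hS x hx)).ne'
  have h3 := contDiffOn_pi.1 (contDiffOn_axesDeriv hf hh hS) 2
  have h4 : ContDiffOn ℝ ∞ (fun x => b₃ (f x) / f x 0) S := by fun_prop (disch := assumption)
  have h5 : ContDiffOn ℝ ∞ (fun x => b₃ (f x) / f x 1) S := by fun_prop (disch := assumption)
  exact contDiffOn_vec2 (ContDiffOn.sub (by fun_prop) (h4.mul h3))
    (ContDiffOn.sub (by fun_prop) (h5.mul h3))

theorem contDiffOn_matK_mulVec {f h : E → V2} (hf : ContDiffOn ℝ ∞ f S) (hh : ContDiffOn ℝ ∞ h S)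
    (hS : ∀ x ∈ S, f x ∈ setB) : ContDiffOn ℝ ∞ (fun x => matK (f x) *ᵥ h x) S := by
  have hD := fun x hx => (matK_denom_pos (hS x hx)).ne'
  simp only [matK_mulVec]
  refine contDiffOn_vec2 ?_ ?_ <;> fun_prop (disch := assumption)

theorem contDiffOn_applyJ {f : E → V2} {h : E → V3 × V3} (hf : ContDiffOn ℝ ∞ f S)
    (hh : ContDiffOn ℝ ∞ h S) (hS : ∀ x ∈ S, f x ∈ setB) :
    ContDiffOn ℝ ∞ (fun x => applyJ (f x) (h x)) S := by
  have h1 : ∀ x ∈ S, (f x 1 ^ 2 - b₃ (f x) ^ 2) ^ 2 ≠ 0 := fun x hx =>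
    pow_ne_zero 2 (axes_sq_sub_pos (hS x hx)).1.ne'
  have h2 : ∀ x ∈ S, (f x 0 ^ 2 - b₃ (f x) ^ 2) ^ 2 ≠ 0 := fun x hx =>
    pow_ne_zero 2 (axes_sq_sub_pos (hS x hx)).2.1.ne'
  have h3 : ∀ x ∈ S, (f x 0 ^ 2 - f x 1 ^ 2) ^ 2 ≠ 0 := fun x hx =>
    pow_ne_zero 2 (axes_sq_sub_pos (hS x hx)).2.2.ne'
  simp only [applyJ_eq]
  refine ContDiffOn.prodMk (contDiffOn_vec3 ?_ ?_ ?_) (contDiffOn_vec3 ?_ ?_ ?_) <;>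
    fun_prop (disch := assumption)

theorem contDiffOn_inertia {f : E → V2} {h : E → V3 × V3} (hf : ContDiffOn ℝ ∞ f S)
    (hh : ContDiffOn ℝ ∞ h S) (hS : ∀ x ∈ S, f x ∈ setB) :
    ContDiffOn ℝ ∞ (fun x => inertia (f x) (h x)) S := by
  unfold inertia inertiaOf
  refine ContDiffOn.prodMk (contDiffOn_vec3 ?_ ?_ ?_) (contDiffOn_vec3 ?_ ?_ ?_) <;>
    fun_prop (disch := assumption)

@[fun_prop]
theorem contDiffOn_dotProduct {ι : Type*} [Fintype ι] {f h : E → ι → ℝ} (hf : ContDiffOn ℝ n f S)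
    (hh : ContDiffOn ℝ n h S) : ContDiffOn ℝ n (fun x => f x ⬝ᵥ h x) S := by
  unfold dotProduct
  fun_prop

@[fun_prop]
theorem contDiffOn_dot2 {f h : E → V3 × V3} (hf : ContDiffOn ℝ n f S)
    (hh : ContDiffOn ℝ n h S) : ContDiffOn ℝ n (fun x => dot2 (f x) (h x)) S := by
  unfold dot2
  fun_prop

@[fun_prop]
theorem contDiffOn_cross2 {f h : E → V3 × V3} (hf : ContDiffOn ℝ n f S)
    (hh : ContDiffOn ℝ n h S) : ContDiffOn ℝ n (fun x => cross2 (f x) (h x)) S := by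
  simp only [cross2, cross_apply]
  refine ContDiffOn.prodMk (contDiffOn_vec3 ?_ ?_ ?_) (contDiffOn_vec3 ?_ ?_ ?_) <;> fun_prop

end Smoothness

theorem contDiffOn_hamiltonian (g : ℝ) :
    ContDiffOn ℝ ∞ (hamiltonian g) {p | p.1 ∈ setB} := by
  have hS : ∀ p ∈ {p : PhaseSpace | p.1 ∈ setB}, p.1 ∈ setB := fun p hp => hp
  have h1 := contDiffOn_matK_mulVec (S := {p : PhaseSpace | p.1 ∈ setB}) (f := fun p => p.1)
    (h := fun p => p.2.1) (by fun_prop) (by fun_prop) hS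
  have h2 := contDiffOn_applyJ (S := {p : PhaseSpace | p.1 ∈ setB}) (f := fun p => p.1)
    (h := fun p => p.2.2.2) (by fun_prop) (by fun_prop) hS
  have h3 : ContDiffOn ℝ ∞ (fun p : PhaseSpace => potential g (axes p.1)) {p | p.1 ∈ setB} :=
    (contDiffOn_potential g).comp (contDiffOn_axes.comp contDiffOn_fst
      fun p hp => mul_ne_zero_of_mem hp) fun p hp => axes_pos hp
  have h4 : ContDiffOn ℝ ∞ (fun p : PhaseSpace => p.2.1 ⬝ᵥ (matK p.1 *ᵥ p.2.1)) {p | p.1 ∈ setB} :=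
    contDiffOn_dotProduct (by fun_prop) h1
  have h5 : ContDiffOn ℝ ∞ (fun p : PhaseSpace => dot2 p.2.2.2 (applyJ p.1 p.2.2.2))
      {p | p.1 ∈ setB} := contDiffOn_dot2 (by fun_prop) h2
  exact ((contDiffOn_const.mul h4).add (contDiffOn_const.mul h5)).add h3

theorem isOpen_fst_mem_setB : IsOpen {p : PhaseSpace | p.1 ∈ setB} :=
  isOpen_setB.preimage continuous_fst

/-! ### The phase space as tangent and cotangent bundle -/

theorem smoothOn_of_contDiffOn {E F : Type*} [NormedAddCommGroup E] [NormedSpace ℝ E]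
    [NormedAddCommGroup F] [NormedSpace ℝ F] {f : E → F} {S O : Set E} (hO : IsOpen O)
    (hSO : S ⊆ O) (hf : ContDiffOn ℝ ∞ f O) : SmoothOn f S :=
  fun _ hp => ⟨O, hO, hSO hp, f, hf, fun _ _ => rfl⟩

/-- Bundle maps `p ↦ (config p, (α'(b) 𝕂(b) c, U ω̂))` with `ω = T b m` depending invertibly on `m`.
The cases `T b m = 𝕁(b) m` and `T b m = m` give the Legendre map and the identification with the
cotangent bundle. -/
noncomputable def bundleMap (T : V2 → V3 × V3 → V3 × V3) (p : PhaseSpace) : ConfSpace × ConfSpace :=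
  (config p, configTangent p (matK p.1 *ᵥ p.2.1) (T p.1 p.2.2.2))

theorem contDiffOn_bundleMap {T : V2 → V3 × V3 → V3 × V3}
    (hT : ContDiffOn ℝ ∞ (fun p : PhaseSpace => T p.1 p.2.2.2) {p | p.1 ∈ setB}) :
    ContDiffOn ℝ ∞ (bundleMap T) {p | p.1 ∈ setB} := by
  have hS : ∀ p ∈ {p : PhaseSpace | p.1 ∈ setB}, p.1 ∈ setB := fun p hp => hp
  have h1 := contDiffOn_matK_mulVec (S := {p : PhaseSpace | p.1 ∈ setB}) (f := fun p => p.1)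
    (h := fun p => p.2.1) (by fun_prop) (by fun_prop) hS
  have h2 := contDiffOn_diagonal (contDiffOn_axesDeriv (f := fun p : PhaseSpace => p.1)
    (by fun_prop) h1 hS)
  have h3 : ContDiffOn ℝ ∞ (fun p : PhaseSpace => fderiv ℝ alpha p.1 (matK p.1 *ᵥ p.2.1))
      {p | p.1 ∈ setB} := h2.congr fun p hp => fderiv_alpha (mul_ne_zero_of_mem hp) _
  have h4 : ContDiffOn ℝ ∞ (fun p : PhaseSpace => alpha p.1) {p | p.1 ∈ setB} :=
    contDiffOn_alpha.comp contDiffOn_fst fun p hp => mul_ne_zero_of_mem hp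
  have hl : ContDiffOn ℝ ∞ (fun p : PhaseSpace => p.2.2.1.1 * hat (T p.1 p.2.2.2).1)
      {p | p.1 ∈ setB} := contDiffOn_mat_mul (by fun_prop) (contDiffOn_hat hT.fst)
  have hr : ContDiffOn ℝ ∞ (fun p : PhaseSpace => p.2.2.1.2 * hat (T p.1 p.2.2.2).2)
      {p | p.1 ∈ setB} := contDiffOn_mat_mul (by fun_prop) (contDiffOn_hat hT.snd)
  exact (h4.prodMk (ContDiffOn.prodMk (by fun_prop) (by fun_prop))).prodMk
    (h3.prodMk (hl.prodMk hr))

theorem isDiffeo_bundleMap {T T' : V2 → V3 × V3 → V3 × V3}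
    (hT : ContDiffOn ℝ ∞ (fun p : PhaseSpace => T p.1 p.2.2.2) {p | p.1 ∈ setB})
    (hT' : ContDiffOn ℝ ∞ (fun p : V2 × V3 × V3 => T' p.1 p.2) {p | p.1 ∈ setB})
    (hTT' : ∀ b ∈ setB, ∀ om, T b (T' b om) = om) (hT'T : ∀ b ∈ setB, ∀ m, T' b (T b m) = m) :
    IsDiffeo (bundleMap T) phaseM (tangentBundle Conf) := by
  refine ⟨fun p hp => ⟨config_mem hp, configTangent_mem_tangentAt hp _ _⟩,
    smoothOn_of_contDiffOn isOpen_fst_mem_setB (fun p hp => hp.1) (contDiffOn_bundleMap hT),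
    fun z => (firstTwo z.1.1, gram (firstTwo z.1.1) (firstTwo z.2.1), (z.1.2.1, z.1.2.2),
      T' (firstTwo z.1.1) (vee (z.1.2.1ᵀ * z.2.2.1), vee (z.1.2.2ᵀ * z.2.2.2))), ?_, ?_, ?_, ?_⟩
  · rintro z ⟨hz, -⟩
    exact ⟨(mem_setA_iff.1 hz.1).1, hz.2.1, hz.2.2⟩
  · have hc : Continuous fun z : ConfSpace × ConfSpace => firstTwo z.1.1 :=
      (contDiffOn_univ.1 (contDiffOn_firstTwo (n := 0) (by fun_prop))).continuous
    refine smoothOn_of_contDiffOn (O := {z | firstTwo z.1.1 ∈ setB}) (isOpen_setB.preimage hc)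
      (fun z hz => (mem_setA_iff.1 hz.1.1).1) ?_
    have h1 : ContDiffOn ℝ ∞ (fun z : ConfSpace × ConfSpace => firstTwo z.1.1)
      {z | firstTwo z.1.1 ∈ setB} := by fun_prop
    have h2 := contDiffOn_gram h1 (h := fun z => firstTwo z.2.1) (by fun_prop) fun z hz => hz
    have h3 := hT'.comp (s := {z : ConfSpace × ConfSpace | firstTwo z.1.1 ∈ setB})
      (f := fun z => (firstTwo z.1.1, vee (z.1.2.1ᵀ * z.2.2.1), vee (z.1.2.2ᵀ * z.2.2.2)))
      (by fun_prop) fun z hz => hz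
    exact h1.prodMk (h2.prodMk (ContDiffOn.prodMk (by fun_prop) h3))
  · intro p hp
    simp only [bundleMap, config, configTangent, firstTwo_alpha,
      firstTwo_fderiv_alpha (mul_ne_zero_of_mem hp.1), gram_matK_mulVec hp.1,
      vee_transpose_mul_mul_hat hp.2.1, vee_transpose_mul_mul_hat hp.2.2, Prod.mk.eta,
      hT'T _ hp.1]
  · rintro ⟨q, X⟩ ⟨hq, hX⟩
    obtain ⟨hB, hA⟩ := mem_setA_iff.1 hq.1
    simp only [bundleMap, matK_mulVec_gram hB, hTT' _ hB]
    set p : PhaseSpace := (firstTwo q.1, gram (firstTwo q.1) (firstTwo X.1), (q.2.1, q.2.2),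
      T' (firstTwo q.1) (vee (q.2.1ᵀ * X.2.1), vee (q.2.2ᵀ * X.2.2))) with hp
    have hconf : config p = q := Prod.ext hA rfl
    have hpM : p ∈ phaseM := ⟨hB, hq.2.1, hq.2.2⟩
    have := configTangent_of_mem hpM (by rw [hconf]; exact hX)
    rw [hconf, this]

theorem isDiffeo_toTangent : IsDiffeo toTangent phaseM (tangentBundle Conf) :=
  isDiffeo_bundleMap (T := applyJ) (T' := inertia)
    (contDiffOn_applyJ (by fun_prop) (by fun_prop) fun p hp => hp)
    (contDiffOn_inertia (by fun_prop) (by fun_prop) fun p hp => hp)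
    (fun _ hb => applyJ_inertia hb) (fun _ hb => inertia_applyJ hb)

/-- The identification of the phase space with the cotangent bundle. -/
noncomputable def toCotangent : PhaseSpace → ConfSpace × ConfSpace := bundleMap fun _ m => m

theorem isDiffeo_toCotangent : IsDiffeo toCotangent phaseM cotangentBundle :=
  isDiffeo_bundleMap (T' := fun _ m => m) (by fun_prop) (by fun_prop) (fun _ _ _ => rfl)
    (fun _ _ _ => rfl)

theorem half_trace_hat {U : Mat3} (hU : U ∈ SO3) (x y : V3) :
    (1 / 2) * ((U * hat x) * (U * hat y)ᵀ).trace = x ⬝ᵥ y := by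
  rw [Matrix.transpose_mul, Matrix.trace_mul_comm, Matrix.mul_assoc, transpose_mul_mul_hat hU]
  simp [hat, Matrix.trace, Matrix.mul_apply, Fin.sum_univ_three, dotProduct]
  ring

theorem pairing_toCotangent {p : PhaseSpace} (hp : p ∈ phaseM) (v : V2) (om : V3 × V3) :
    pairing (toCotangent p).2 (configTangent p v om) = p.2.1 ⬝ᵥ v + dot2 p.2.2.2 om := by
  have h : ∀ x y : V3, (Matrix.diagonal x * (Matrix.diagonal y)ᵀ).trace = x ⬝ᵥ y := fun x y => by
    simp [Matrix.diagonal_transpose, Matrix.diagonal_mul_diagonal, Matrix.trace_diagonal,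
      dotProduct]
  simp only [pairing, toCotangent, bundleMap, configTangent, half_trace_hat hp.2.1,
    half_trace_hat hp.2.2, fderiv_alpha (mul_ne_zero_of_mem hp.1), h]
  rw [← gram_dotProduct, gram_matK_mulVec hp.1, dot2, add_assoc]

/-! ### The symplectic form -/

section Forms

variable {E : Type*} [NormedAddCommGroup E] [NormedSpace ℝ E]

theorem hasDerivAt_line (x u : E) : HasDerivAt (fun s : ℝ => x + s • u) u 0 := by
  simpa using ((hasDerivAt_id (0 : ℝ)).smul_const u).const_add x

theorem hasDerivAt_comp_line {F : Type*} [NormedAddCommGroup F] [NormedSpace ℝ F] {f : E → F}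
    {x : E} (hf : DifferentiableAt ℝ f x) (u : E) :
    HasDerivAt (fun s : ℝ => f (x + s • u)) (fderiv ℝ f x u) 0 := by
  have h : HasFDerivAt f (fderiv ℝ f x) (x + (0 : ℝ) • u) := by simpa using hf.hasFDerivAt
  exact h.comp_hasDerivAt 0 (hasDerivAt_line x u)

theorem eventually_line_mem {d : ℕ} {W : Set (Fin d → ℝ)} (hW : IsOpen W) {x : Fin d → ℝ}
    (hx : x ∈ W) (u : Fin d → ℝ) : ∀ᶠ s : ℝ in nhds 0, x + s • u ∈ W :=
  (hasDerivAt_line x u).continuousAt.eventually_mem (hW.mem_nhds (by simpa using hx))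

theorem fderiv_mem_tangentAt {d : ℕ} {W : Set (Fin d → ℝ)} {φ : (Fin d → ℝ) → E} {S : Set E}
    (hW : IsOpen W) (hφ : ContDiffOn ℝ ∞ φ W) (hS : Set.MapsTo φ W S) {x : Fin d → ℝ} (hx : x ∈ W)
    (u : Fin d → ℝ) : fderiv ℝ φ x u ∈ tangentAt S (φ x) := by
  have hd := (hφ.contDiffAt (hW.mem_nhds hx)).differentiableAt (by simp)
  exact ⟨_, (eventually_line_mem hW hx u).mono fun s hs => hS hs, by simp,
    hasDerivAt_comp_line hd u⟩

theorem differentiableAt_fderiv_apply {F : Type*} [NormedAddCommGroup F] [NormedSpace ℝ F]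
    {f : E → F} {x : E} (hf : ContDiffAt ℝ ∞ f x) (v : E) :
    DifferentiableAt ℝ (fun y => fderiv ℝ f y v) x :=
  ((hf.fderiv_right (m := 1) (by norm_cast)).differentiableAt (by simp)).clm_apply
    (differentiableAt_const v)

theorem fderiv_fderiv_apply_comm {F : Type*} [NormedAddCommGroup F] [NormedSpace ℝ F]
    {f : E → F} {x : E} (hf : ContDiffAt ℝ ∞ f x) (u v : E) :
    fderiv ℝ (fun y => fderiv ℝ f y v) x u = fderiv ℝ (fun y => fderiv ℝ f y u) x v := by
  have h (u v : E) : fderiv ℝ (fun y => fderiv ℝ f y v) x u = fderiv ℝ (fderiv ℝ f) x u v := by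
    have h := ((hf.fderiv_right (m := 1) (by norm_cast)).differentiableAt
      (by simp)).hasFDerivAt.clm_apply (hasFDerivAt_const v x)
    simp [h.fderiv]
  rw [h, h]
  refine hf.isSymmSndFDerivAt ?_ u v
  rw [minSmoothness_of_isRCLikeNormedField]
  exact WithTop.coe_le_coe.2 (le_top : (2 : ℕ∞) ≤ ⊤)

/-- `d ∘ d = 0`. -/
theorem extD₂_extD₁ {d : ℕ} {W : Set (Fin d → ℝ)} {β : (Fin d → ℝ) → (Fin d → ℝ) → ℝ}
    (hW : IsOpen W) (hβ : ∀ u, ContDiffOn ℝ ∞ (fun y => β y u) W) {x : Fin d → ℝ} (hx : x ∈ W)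
    (u v w : Fin d → ℝ) : extD₂ (extD₁ β) x u v w = 0 := by
  have hβx (u) : ContDiffAt ℝ ∞ (fun y => β y u) x := (hβ u).contDiffAt (hW.mem_nhds hx)
  have key (u v w) : fderiv ℝ (fun y => extD₁ β y v w) x u
      = fderiv ℝ (fun y => fderiv ℝ (fun z => β z w) y v) x u
        - fderiv ℝ (fun y => fderiv ℝ (fun z => β z v) y w) x u := by
    have h1 := (differentiableAt_fderiv_apply (hβx w) v).hasFDerivAt.sub
      (differentiableAt_fderiv_apply (hβx v) w).hasFDerivAt
    exact DFunLike.congr_fun h1.fderiv u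
  rw [extD₂, key, key, key, fderiv_fderiv_apply_comm (hβx w) u v,
    fderiv_fderiv_apply_comm (hβx v) w u, fderiv_fderiv_apply_comm (hβx u) v w]
  ring

end Forms

/-- The one-form `c·db + m·ω` on the phase space. -/
noncomputable def theta (p X : PhaseSpace) : ℝ :=
  p.2.1 ⬝ᵥ X.1 + dot2 p.2.2.2 (triv p X).2.2.1

theorem hasDerivAt_config {γ : ℝ → PhaseSpace} {X : PhaseSpace} {t : ℝ}
    (hγ : ∀ᶠ s in nhds t, γ s ∈ phaseM) (hX : HasDerivAt γ X t) :
    HasDerivAt (fun s => config (γ s))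
      (configTangent (γ t) (triv (γ t) X).1 (triv (γ t) X).2.2.1) t := by
  have h1 : HasDerivAt (fun s => (γ s).1) X.1 t := hX.fst
  have hl := velocity_SO3 (hγ.mono fun s hs => hs.2.1) hX.snd.snd.fst.fst
  have hr := velocity_SO3 (hγ.mono fun s hs => hs.2.2) hX.snd.snd.fst.snd
  have hα := hasDerivAt_alpha h1 (mul_ne_zero_of_mem hγ.self_of_nhds.1)
  have hU : HasDerivAt (fun s => (γ s).2.2.1) X.2.2.1 t := hX.snd.snd.fst
  exact (hα.prodMk hU).congr_deriv (Prod.ext rfl (Prod.ext hl.symm hr.symm))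

/-- The identification with the cotangent bundle turns the tautological form into `c·db + m·ω`. -/
theorem tautological_pullback {W : Set (Fin 16 → ℝ)} {φ : (Fin 16 → ℝ) → PhaseSpace}
    (hW : IsOpen W) (hφ : ContDiffOn ℝ ∞ φ W) (hM : Set.MapsTo φ W phaseM) {x : Fin 16 → ℝ}
    (hx : x ∈ W) (u : Fin 16 → ℝ) :
    pullback₁ tautological (toCotangent ∘ φ) x u = pullback₁ theta φ x u := by
  have hd := (hφ.contDiffAt (hW.mem_nhds hx)).differentiableAt (by simp)
  have hcot : DifferentiableAt ℝ toCotangent (φ x) :=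
    ((contDiffOn_bundleMap (by fun_prop)).contDiffAt
      (isOpen_fst_mem_setB.mem_nhds (hM hx).1)).differentiableAt (by simp)
  have h1 := hasDerivAt_comp_line (hcot.comp x hd) u
  have h2 := hasDerivAt_comp_line hd u
  have hconf := hasDerivAt_config ((eventually_line_mem hW hx u).mono fun s hs => hM hs) h2
  simp only [zero_smul, add_zero] at hconf
  have h1' : HasDerivAt (fun s : ℝ => config (φ (x + s • u)))
    (fderiv ℝ (toCotangent ∘ φ) x u).1 0 := h1.fst
  exact (congrArg (pairing _) (h1'.unique hconf)).trans (pairing_toCotangent (hM hx) _ _)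

theorem triv_add (p X Y : PhaseSpace) : triv p (X + Y) = triv p X + triv p Y := by
  simp [triv, Matrix.mul_add, vee_add]

theorem triv_smul (p : PhaseSpace) (r : ℝ) (X : PhaseSpace) :
    triv p (r • X) = r • triv p X := by
  simp [triv, vee_smul]

theorem vee_hat_mul_hat_sub (x y : V3) : vee (hat x * hat y - hat y * hat x) = x ⨯₃ y := by
  ext i
  fin_cases i <;> simp [vee, hat, cross_apply] <;> ring

theorem hasDerivAt_dotProduct {ι : Type*} [Fintype ι] {f h : ℝ → ι → ℝ} {f' h' : ι → ℝ} {t : ℝ}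
    (hf : HasDerivAt f f' t) (hh : HasDerivAt h h' t) :
    HasDerivAt (fun s => f s ⬝ᵥ h s) (f' ⬝ᵥ h t + f t ⬝ᵥ h') t := by
  rw [dotProduct, dotProduct, ← Finset.sum_add_distrib]
  exact HasDerivAt.fun_sum fun i _ => (hasDerivAt_pi.1 hf i).mul (hasDerivAt_pi.1 hh i)

theorem hasDerivAt_vee_transpose_mul {U Y : ℝ → Mat3} {U' Y' : Mat3} {t : ℝ}
    (hU : HasDerivAt U U' t) (hY : HasDerivAt Y Y' t) :
    HasDerivAt (fun s => vee ((U s)ᵀ * Y s)) (vee (U'ᵀ * Y t) + vee ((U t)ᵀ * Y')) t := by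
  rw [← vee_add]
  have hT : HasDerivAt (fun s => (U s)ᵀ) U'ᵀ t := transposeL.hasFDerivAt.comp_hasDerivAt t hU
  exact veeL.hasFDerivAt.comp_hasDerivAt t (hasDerivAt_mat_mul hT hY)

theorem hasDerivAt_theta {γ Y : ℝ → PhaseSpace} {X Z : PhaseSpace} {t : ℝ}
    (hγ : HasDerivAt γ X t) (hY : HasDerivAt Y Z t) :
    HasDerivAt (fun s => theta (γ s) (Y s))
      (X.2.1 ⬝ᵥ (Y t).1 + dot2 X.2.2.2 (triv (γ t) (Y t)).2.2.1
        + dot2 (γ t).2.2.2 (vee (X.2.2.1.1ᵀ * (Y t).2.2.1.1), vee (X.2.2.1.2ᵀ * (Y t).2.2.1.2))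
        + theta (γ t) Z) t := by
  have h1 := hasDerivAt_dotProduct hγ.snd.fst hY.fst
  have h2 := hasDerivAt_dotProduct hγ.snd.snd.snd.fst
    (hasDerivAt_vee_transpose_mul hγ.snd.snd.fst.fst hY.snd.snd.fst.fst)
  have h3 := hasDerivAt_dotProduct hγ.snd.snd.snd.snd
    (hasDerivAt_vee_transpose_mul hγ.snd.snd.fst.snd hY.snd.snd.fst.snd)
  refine (h1.add (h2.add h3)).congr_deriv ?_
  simp [theta, dot2, triv, dotProduct_add]
  ring

theorem contDiffOn_theta {E : Type*} [NormedAddCommGroup E] [NormedSpace ℝ E] {n : WithTop ℕ∞}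
    {S : Set E} {f h : E → PhaseSpace} (hf : ContDiffOn ℝ n f S) (hh : ContDiffOn ℝ n h S) :
    ContDiffOn ℝ n (fun x => theta (f x) (h x)) S := by
  unfold theta triv
  fun_prop

theorem contDiffOn_sigma {E : Type*} [NormedAddCommGroup E] [NormedSpace ℝ E] {n : WithTop ℕ∞}
    {S : Set E} {f h k : E → PhaseSpace} (hf : ContDiffOn ℝ n f S) (hh : ContDiffOn ℝ n h S)
    (hk : ContDiffOn ℝ n k S) : ContDiffOn ℝ n (fun x => sigma (f x) (h x) (k x)) S := by
  unfold sigma sigmaTriv triv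
  fun_prop

theorem transpose_lift_mul_lift {U : Mat3} (hU : U ∈ SO3) (x y : V3) :
    (U * hat x)ᵀ * (U * hat y) = -(hat x * hat y) := by
  rw [Matrix.transpose_mul, hat_transpose, Matrix.mul_assoc, transpose_mul_mul_hat hU,
    Matrix.neg_mul]

theorem sigma_lift {p : PhaseSpace} (hp : p ∈ phaseM) (ξ η : TrivTangent) :
    sigma p (lift p ξ) (lift p η) = sigmaTriv p ξ η := by
  rw [sigma, triv_lift hp, triv_lift hp]

/-- The algebraic identity behind `σ = -dθ`; `r` stands for the second derivatives, which cancel. -/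
theorem sigma_eq_neg_sub {p X Y : PhaseSpace} (hp : p ∈ phaseM) (hX : X ∈ tangentAt phaseM p)
    (hY : Y ∈ tangentAt phaseM p) (r : ℝ) : sigma p X Y =
      -((X.2.1 ⬝ᵥ Y.1 + dot2 X.2.2.2 (triv p Y).2.2.1
        + dot2 p.2.2.2 (vee (X.2.2.1.1ᵀ * Y.2.2.1.1), vee (X.2.2.1.2ᵀ * Y.2.2.1.2)) + r)
      - (Y.2.1 ⬝ᵥ X.1 + dot2 Y.2.2.2 (triv p X).2.2.1
        + dot2 p.2.2.2 (vee (Y.2.2.1.1ᵀ * X.2.2.1.1), vee (Y.2.2.1.2ᵀ * X.2.2.1.2)) + r)) := by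
  obtain ⟨ξ, -, rfl⟩ := (lift_bijOn hp).surjOn hX
  obtain ⟨η, -, rfl⟩ := (lift_bijOn hp).surjOn hY
  have hsub (A B : Mat3) : vee (A - B) = vee A - vee B := veeL.map_sub A B
  have hneg (A : Mat3) : vee (-A) = -vee A := veeL.map_neg A
  rw [sigma_lift hp, triv_lift hp, triv_lift hp]
  simp only [lift, transpose_lift_mul_lift hp.2.1, transpose_lift_mul_lift hp.2.2, sigmaTriv,
    cross2, dot2, ← vee_hat_mul_hat_sub, hsub, hneg, dotProduct_sub,
    dotProduct_neg, dotProduct_comm ξ.1, dotProduct_comm η.1, dotProduct_comm ξ.2.2.1.1,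
    dotProduct_comm ξ.2.2.1.2]
  ring

section Pullback

variable {W : Set (Fin 16 → ℝ)} {φ : (Fin 16 → ℝ) → PhaseSpace}

theorem contDiffOn_fderiv_apply (hW : IsOpen W) (hφ : ContDiffOn ℝ ∞ φ W) (u : Fin 16 → ℝ) :
    ContDiffOn ℝ ∞ (fun x => fderiv ℝ φ x u) W :=
  (hφ.fderiv_of_isOpen hW (by simp)).clm_apply contDiffOn_const

/-- `φ^*σ = -d(φ^*θ)`.  The term `m·(ω × ω')` arises from differentiating the trivialization
`ω̂ = Uᵀ U̇`. -/
theorem pullback_sigma (hW : IsOpen W) (hφ : ContDiffOn ℝ ∞ φ W) (hM : Set.MapsTo φ W phaseM)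
    {x : Fin 16 → ℝ} (hx : x ∈ W) (u v : Fin 16 → ℝ) :
    pullback₂ sigma φ x u v = -extD₁ (pullback₁ theta φ) x u v := by
  have hφx := hφ.contDiffAt (hW.mem_nhds hx)
  have hd := hφx.differentiableAt (by simp)
  have hθ (v) : DifferentiableAt ℝ (fun y => pullback₁ theta φ y v) x :=
    ((contDiffOn_theta hφ (contDiffOn_fderiv_apply hW hφ v)).contDiffAt
      (hW.mem_nhds hx)).differentiableAt (by simp)
  have key (u v) := (hasDerivAt_comp_line (hθ v) u).unique
    (hasDerivAt_theta (hasDerivAt_comp_line hd u)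
      (hasDerivAt_comp_line (differentiableAt_fderiv_apply hφx v) u))
  simp only [zero_smul, add_zero] at key
  rw [extD₁, key u v, key v u, fderiv_fderiv_apply_comm hφx u v, pullback₂]
  exact sigma_eq_neg_sub (hM hx) (fderiv_mem_tangentAt hW hφ hM hx u)
    (fderiv_mem_tangentAt hW hφ hM hx v) _

end Pullback

theorem isSymplecticForm_sigma : IsSymplecticForm 16 phaseM sigma := by
  refine ⟨fun p _ X _ Y _ Z _ r => ?_, fun p _ X _ Y _ => ?_, fun p hp X hX h => ?_,
    fun W φ hW hφ hM => ⟨fun u v => ?_, fun x hx u v w => ?_⟩⟩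
  · simp only [sigma, triv_add, triv_smul, sigmaTriv, dot2, cross2, Prod.fst_add, Prod.snd_add,
      Prod.smul_fst, Prod.smul_snd, add_dotProduct, smul_dotProduct, dotProduct_add,
      dotProduct_smul, map_add, map_smul, LinearMap.add_apply, LinearMap.smul_apply, smul_eq_mul]
    ring
  · simp only [sigma, sigmaTriv, dot2, cross2]
    rw [← cross_anticomm (triv p Y).2.2.1.1, ← cross_anticomm (triv p Y).2.2.1.2,
      dotProduct_comm (triv p X).2.2.1.1, dotProduct_comm (triv p X).2.2.1.2,
      dotProduct_comm (triv p X).2.2.2.1, dotProduct_comm (triv p X).2.2.2.2]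
    simp only [dotProduct_neg]
    ring
  · rw [← lift_triv hX] at h ⊢
    generalize triv p X = ξ at h ⊢
    have h' (η) : sigmaTriv p ξ η = 0 := by
      rw [← sigma_lift hp]
      exact h _ (lift_mem_tangentAt hp η)
    -- the fibre directions detect `v` and `ω`, after which the base directions detect `w` and `n`
    have hv : ξ.1 = 0 := by
      have h := h' (0, ξ.1, 0, 0)
      simp [sigmaTriv, dot2, cross2] at h
      exact dotProduct_self_eq_zero.1 (by simpa [dotProduct, Fin.sum_univ_two] using h)
    have hl : ξ.2.2.1.1 = 0 := by
      simpa [sigmaTriv, dot2, cross2] using h' (0, 0, 0, (ξ.2.2.1.1, 0))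
    have hr : ξ.2.2.1.2 = 0 := by
      simpa [sigmaTriv, dot2, cross2] using h' (0, 0, 0, (0, ξ.2.2.1.2))
    have hw : ξ.2.1 = 0 := by
      have h := h' (ξ.2.1, 0, 0, 0)
      simp [sigmaTriv, dot2, cross2] at h
      refine dotProduct_self_eq_zero.1 ?_
      rw [dotProduct, Fin.sum_univ_two]
      linarith
    have hnl : ξ.2.2.2.1 = 0 := by
      simpa [sigmaTriv, dot2, cross2, hl, hr] using h' (0, 0, (ξ.2.2.2.1, 0), 0)
    have hnr : ξ.2.2.2.2 = 0 := by
      simpa [sigmaTriv, dot2, cross2, hl, hr] using h' (0, 0, (0, ξ.2.2.2.2), 0)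
    have h0 : hat 0 = 0 := hatL.map_zero
    simp [lift, hv, hl, hr, hw, h0]
    exact Prod.ext hnl hnr
  · exact contDiffOn_sigma hφ (contDiffOn_fderiv_apply hW hφ u) (contDiffOn_fderiv_apply hW hφ v)
  · have hβ (u) : ContDiffOn ℝ ∞ (fun y => -pullback₁ theta φ y u) W :=
      (contDiffOn_theta hφ (contDiffOn_fderiv_apply hW hφ u)).neg
    rw [← extD₂_extD₁ hW hβ hx u v w]
    have key (u v w) : fderiv ℝ (fun y => pullback₂ sigma φ y v w) x u
        = fderiv ℝ (fun y => extD₁ (fun y u => -pullback₁ theta φ y u) y v w) x u := by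
      congr 1
      refine Filter.EventuallyEq.fderiv_eq ?_
      filter_upwards [hW.mem_nhds hx] with y hy
      rw [pullback_sigma hW hφ hM hy, extD₁, extD₁, fderiv_fun_neg, fderiv_fun_neg]
      simp
      ring
    rw [extD₂, extD₂, key, key, key]

theorem pullback_sigma_eq_tautological {W : Set (Fin 16 → ℝ)} {φ : (Fin 16 → ℝ) → PhaseSpace}
    (hW : IsOpen W) (hφ : ContDiffOn ℝ ∞ φ W) (hM : Set.MapsTo φ W phaseM)
    {x : Fin 16 → ℝ} (hx : x ∈ W) (u v : Fin 16 → ℝ) :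
    pullback₂ sigma φ x u v = -extD₁ (pullback₁ tautological (toCotangent ∘ φ)) x u v := by
  have h (u) : (fun y => pullback₁ tautological (toCotangent ∘ φ) y u)
      =ᶠ[nhds x] fun y => pullback₁ theta φ y u := by
    filter_upwards [hW.mem_nhds hx] with y hy using tautological_pullback hW hφ hM hy u
  rw [pullback_sigma hW hφ hM hx, extD₁, extD₁, (h u).fderiv_eq, (h v).fderiv_eq]

/-! ### Derivatives of momenta and energies along curves -/

theorem hasDerivAt_vec3 {f : ℝ → V3} {f' : V3} {t : ℝ} (h0 : HasDerivAt (fun s => f s 0) (f' 0) t)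
    (h1 : HasDerivAt (fun s => f s 1) (f' 1) t) (h2 : HasDerivAt (fun s => f s 2) (f' 2) t) :
    HasDerivAt f f' t :=
  hasDerivAt_pi.2 fun i => by fin_cases i <;> assumption

/-- The second derivative of `b₃`. -/
noncomputable def b₃Hess (b v u : V2) : ℝ :=
  b₃ b * (2 * (v 0 * u 0) / b 0 ^ 2 + (v 0 * u 1 + v 1 * u 0) / (b 0 * b 1)
    + 2 * (v 1 * u 1) / b 1 ^ 2)

theorem b₃Hess_comm (b v u : V2) : b₃Hess b v u = b₃Hess b u v := by
  simp only [b₃Hess]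
  ring

theorem hasDerivAt_axesDeriv {β v : ℝ → V2} {u v' : V2} {t : ℝ} (hβ : HasDerivAt β u t)
    (hv : HasDerivAt v v' t) (hb : β t 0 * β t 1 ≠ 0) :
    HasDerivAt (fun s => axesDeriv (β s) (v s))
      (axesDeriv (β t) v' + ![0, 0, b₃Hess (β t) (v t) u]) t := by
  have h0 : β t 0 ≠ 0 := left_ne_zero_of_mul hb
  have h1 : β t 1 ≠ 0 := right_ne_zero_of_mul hb
  have hβi := hasDerivAt_pi.1 hβ
  have hvi := hasDerivAt_pi.1 hv
  have h3 := hasDerivAt_pi.1 (hasDerivAt_axes hβ hb) 2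
  refine hasDerivAt_vec3 ?_ ?_ ?_
  · exact (hvi 0).congr_deriv (by simp [axesDeriv])
  · exact (hvi 1).congr_deriv (by simp [axesDeriv])
  · refine (h3.mul (((hvi 0).div (hβi 0) h0).add ((hvi 1).div (hβi 1) h1))).neg.congr_deriv ?_
    simp [axes, axesDeriv, b₃Hess]
    field_simp
    ring

/-- The derivative of the momentum `c = gram b v`, paired with a fixed velocity `e`. -/
theorem momentum_deriv_dotProduct {β c v : ℝ → V2} {u w v' : V2} {t : ℝ} (hβ : HasDerivAt β u t)
    (hc : HasDerivAt c w t) (hv : HasDerivAt v v' t) (hb : β t 0 * β t 1 ≠ 0)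
    (hcv : ∀ᶠ s in nhds t, c s = gram (β s) (v s)) (e : V2) :
    w ⬝ᵥ e = (axesDeriv (β t) v' + ![0, 0, b₃Hess (β t) (v t) u]) ⬝ᵥ axesDeriv (β t) e
      + axesDeriv (β t) (v t) 2 * b₃Hess (β t) e u := by
  have h1 := hasDerivAt_dotProduct hc (hasDerivAt_const t e)
  have h2 := hasDerivAt_dotProduct (hasDerivAt_axesDeriv hβ hv hb)
    (hasDerivAt_axesDeriv hβ (hasDerivAt_const t e) hb)
  have h3 := h1.unique (h2.congr_of_eventuallyEq (hcv.mono fun s hs => by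
    simp only [hs, gram_dotProduct]))
  rw [dotProduct_zero, add_zero] at h3
  rw [h3]
  simp [dotProduct, Fin.sum_univ_three, axesDeriv]

/-- With `c = gram b v` the variation of `½ c·v` under a variation of `b` alone is minus that of
`½ |α'(b)v|²` at fixed `v`. -/
theorem hasDerivAt_baseEnergy {β c v : ℝ → V2} {u w v' : V2} {t : ℝ} (hβ : HasDerivAt β u t)
    (hc : HasDerivAt c w t) (hv : HasDerivAt v v' t) (hb : β t 0 * β t 1 ≠ 0)
    (hcv : ∀ᶠ s in nhds t, c s = gram (β s) (v s)) :
    HasDerivAt (fun s => (1 / 2) * (c s ⬝ᵥ v s))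
      (w ⬝ᵥ v t - axesDeriv (β t) (v t) 2 * b₃Hess (β t) (v t) u) t := by
  refine ((hasDerivAt_dotProduct hc hv).const_mul (1 / 2)).congr_deriv ?_
  have h := momentum_deriv_dotProduct hβ hc hv hb hcv (v t)
  rw [hcv.self_of_nhds, gram_dotProduct, h]
  simp [dotProduct, Fin.sum_univ_three]
  ring

/-- The derivative of `inertiaOf` with respect to the axes, in direction `e`. -/
noncomputable def inertiaVar (a e : V3) (om : V3 × V3) : V3 × V3 :=
  (![2 * (a 1 * e 1 + a 2 * e 2) * om.1 0 - 2 * (e 1 * a 2 + a 1 * e 2) * om.2 0,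
     2 * (a 0 * e 0 + a 2 * e 2) * om.1 1 - 2 * (e 0 * a 2 + a 0 * e 2) * om.2 1,
     2 * (a 0 * e 0 + a 1 * e 1) * om.1 2 - 2 * (e 0 * a 1 + a 0 * e 1) * om.2 2],
   ![2 * (a 1 * e 1 + a 2 * e 2) * om.2 0 - 2 * (e 1 * a 2 + a 1 * e 2) * om.1 0,
     2 * (a 0 * e 0 + a 2 * e 2) * om.2 1 - 2 * (e 0 * a 2 + a 0 * e 2) * om.1 1,
     2 * (a 0 * e 0 + a 1 * e 1) * om.2 2 - 2 * (e 0 * a 1 + a 0 * e 1) * om.1 2])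

theorem hasDerivAt_inertia_entry {x y l r : ℝ → ℝ} {x' y' l' r' t : ℝ} (hx : HasDerivAt x x' t)
    (hy : HasDerivAt y y' t) (hl : HasDerivAt l l' t) (hr : HasDerivAt r r' t) :
    HasDerivAt (fun s => (x s ^ 2 + y s ^ 2) * l s - 2 * x s * y s * r s)
      (2 * (x t * x' + y t * y') * l t - 2 * (x' * y t + x t * y') * r t
        + ((x t ^ 2 + y t ^ 2) * l' - 2 * x t * y t * r')) t := by
  refine ((((hx.pow 2).add (hy.pow 2)).mul hl).sub
    (((hx.const_mul 2).mul hy).mul hr)).congr_deriv ?_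
  simp
  ring

theorem hasDerivAt_inertiaOf {a : ℝ → V3} {om : ℝ → V3 × V3} {a' : V3} {om' : V3 × V3} {t : ℝ}
    (ha : HasDerivAt a a' t) (hom : HasDerivAt om om' t) :
    HasDerivAt (fun s => inertiaOf (a s) (om s))
      (inertiaVar (a t) a' (om t) + inertiaOf (a t) om') t := by
  have hai := hasDerivAt_pi.1 ha
  have hl := hasDerivAt_pi.1 hom.fst
  have hr := hasDerivAt_pi.1 hom.snd
  exact (hasDerivAt_vec3 (hasDerivAt_inertia_entry (hai 1) (hai 2) (hl 0) (hr 0))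
    (hasDerivAt_inertia_entry (hai 0) (hai 2) (hl 1) (hr 1))
    (hasDerivAt_inertia_entry (hai 0) (hai 1) (hl 2) (hr 2))).prodMk
    (hasDerivAt_vec3 (hasDerivAt_inertia_entry (hai 1) (hai 2) (hr 0) (hl 0))
    (hasDerivAt_inertia_entry (hai 0) (hai 2) (hr 1) (hl 1))
    (hasDerivAt_inertia_entry (hai 0) (hai 1) (hr 2) (hl 2)))

theorem hasDerivAt_dot2 {f h : ℝ → V3 × V3} {f' h' : V3 × V3} {t : ℝ}
    (hf : HasDerivAt f f' t) (hh : HasDerivAt h h' t) :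
    HasDerivAt (fun s => dot2 (f s) (h s)) (dot2 f' (h t) + dot2 (f t) h') t := by
  refine ((hasDerivAt_dotProduct hf.fst hh.fst).add
    (hasDerivAt_dotProduct hf.snd hh.snd)).congr_deriv ?_
  simp only [dot2]
  ring

/-- The analogue of `hasDerivAt_baseEnergy` for the rotational energy. -/
theorem hasDerivAt_rotEnergy {a : ℝ → V3} {m om : ℝ → V3 × V3} {a' : V3} {n om' : V3 × V3} {t : ℝ}
    (ha : HasDerivAt a a' t) (hm : HasDerivAt m n t) (hom : HasDerivAt om om' t)
    (hmo : ∀ᶠ s in nhds t, m s = inertiaOf (a s) (om s)) :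
    HasDerivAt (fun s => (1 / 2) * dot2 (m s) (om s))
      (dot2 n (om t) - (1 / 2) * dot2 (inertiaVar (a t) a' (om t)) (om t)) t := by
  refine ((hasDerivAt_dot2 hm hom).const_mul (1 / 2)).congr_deriv ?_
  have h := hm.unique ((hasDerivAt_inertiaOf ha hom).congr_of_eventuallyEq hmo)
  rw [hmo.self_of_nhds, h]
  simp [dot2, inertiaOf, inertiaVar, dotProduct, Fin.sum_univ_three]
  ring

/-! ### Hamilton's equations -/

/-- The right-hand side `-∂H/∂b` of Hamilton's equation for `ċ`, in direction `u`.  By duality the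
derivatives of the inverse matrices `𝕂` and `𝕁` are expressed by those of the metric itself. -/
noncomputable def force (g : ℝ) (p : PhaseSpace) (u : V2) : ℝ :=
  axesDeriv p.1 (matK p.1 *ᵥ p.2.1) 2 * b₃Hess p.1 (matK p.1 *ᵥ p.2.1) u
    + (1 / 2) * dot2 (inertiaVar (axes p.1) (axesDeriv p.1 u) (applyJ p.1 p.2.2.2))
        (applyJ p.1 p.2.2.2)
    - fderiv ℝ (potential g) (axes p.1) (axesDeriv p.1 u)

theorem differentiableAt_matK_mulVec {p : PhaseSpace} (hp : p.1 ∈ setB) :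
    DifferentiableAt ℝ (fun q : PhaseSpace => matK q.1 *ᵥ q.2.1) p :=
  ((contDiffOn_matK_mulVec (S := {q : PhaseSpace | q.1 ∈ setB}) (by fun_prop) (by fun_prop)
    fun _ hq => hq).contDiffAt (isOpen_fst_mem_setB.mem_nhds hp)).differentiableAt (by simp)

theorem differentiableAt_applyJ {p : PhaseSpace} (hp : p.1 ∈ setB) :
    DifferentiableAt ℝ (fun q : PhaseSpace => applyJ q.1 q.2.2.2) p :=
  ((contDiffOn_applyJ (S := {q : PhaseSpace | q.1 ∈ setB}) (by fun_prop) (by fun_prop)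
    fun _ hq => hq).contDiffAt (isOpen_fst_mem_setB.mem_nhds hp)).differentiableAt (by simp)

theorem fderiv_hamiltonian (g : ℝ) {p : PhaseSpace} (hp : p.1 ∈ setB) (Y : PhaseSpace) :
    fderiv ℝ (hamiltonian g) p Y =
      (matK p.1 *ᵥ p.2.1) ⬝ᵥ Y.2.1 + dot2 (applyJ p.1 p.2.2.2) Y.2.2.2 - force g p Y.1 := by
  have hH := ((contDiffOn_hamiltonian g).contDiffAt
    (isOpen_fst_mem_setB.mem_nhds hp)).differentiableAt (by simp)
  have hl := hasDerivAt_line p Y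
  have hnear : ∀ᶠ s : ℝ in nhds 0, (p + s • Y).1 ∈ setB :=
    hl.continuousAt.eventually_mem (isOpen_fst_mem_setB.mem_nhds (by simpa using hp))
  have hv := hasDerivAt_comp_line (differentiableAt_matK_mulVec hp) Y
  have hom := hasDerivAt_comp_line (differentiableAt_applyJ hp) Y
  have hβ : HasDerivAt (fun s : ℝ => (p + s • Y).1) Y.1 0 := hl.fst
  have hb : ((p + (0 : ℝ) • Y).1 0) * ((p + (0 : ℝ) • Y).1 1) ≠ 0 := by
    simpa using mul_ne_zero_of_mem hp
  have h1 := hasDerivAt_baseEnergy hβ hl.snd.fst hv hb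
    (hnear.mono fun s hs => (gram_matK_mulVec hs _).symm)
  have h2 := hasDerivAt_rotEnergy (hasDerivAt_axes hβ hb) hl.snd.snd.snd hom
    (hnear.mono fun s hs => (inertia_applyJ hs _).symm)
  have hpot : DifferentiableAt ℝ (potential g) (axes p.1) :=
    ((contDiffOn_potential g).contDiffAt
      (isOpen_forall_pos.mem_nhds (axes_pos hp))).differentiableAt (by simp)
  have hpot' : HasFDerivAt (potential g) (fderiv ℝ (potential g) (axes p.1))
      (axes (p + (0 : ℝ) • Y).1) := by simpa using hpot.hasFDerivAt
  have h3 := hpot'.comp_hasDerivAt 0 (hasDerivAt_axes hβ hb)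
  have h := (hasDerivAt_comp_line hH Y).unique ((h1.add h2).add h3)
  refine h.trans ?_
  rw [force, dotProduct_comm (matK p.1 *ᵥ p.2.1)]
  simp only [zero_smul, add_zero, dot2, dotProduct_comm (applyJ p.1 p.2.2.2).1,
    dotProduct_comm (applyJ p.1 p.2.2.2).2]
  ring

theorem dot2_cross2 (m om om' : V3 × V3) : dot2 m (cross2 om om') = dot2 (cross2 m om) om' := by
  simp [dot2, cross2, cross_apply, dotProduct, Fin.sum_univ_three]
  ring

theorem dot2_self_eq_zero {x : V3 × V3} (h : dot2 x x = 0) : x = 0 := by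
  have h1 : 0 ≤ x.1 ⬝ᵥ x.1 := Finset.sum_nonneg fun i _ => mul_self_nonneg _
  have h2 : 0 ≤ x.2 ⬝ᵥ x.2 := Finset.sum_nonneg fun i _ => mul_self_nonneg _
  rw [dot2] at h
  exact Prod.ext (dotProduct_self_eq_zero.1 (by linarith)) (dotProduct_self_eq_zero.1 (by linarith))

/-- The equation `σ(X, ·) = dH` in components: `ḃ = 𝕂c`, `ω = 𝕁m`, `ċ = -∂H/∂b`, `ṁ = m × ω`. -/
theorem hamilton_iff (g : ℝ) {p : PhaseSpace} (hp : p ∈ phaseM) (ξ : TrivTangent) :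
    (∀ Y ∈ tangentAt phaseM p, sigma p (lift p ξ) Y = fderiv ℝ (hamiltonian g) p Y) ↔
      (ξ.1 = matK p.1 *ᵥ p.2.1 ∧ ξ.2.2.1 = applyJ p.1 p.2.2.2) ∧
      (∀ u, ξ.2.1 ⬝ᵥ u = force g p u) ∧ ξ.2.2.2 = cross2 p.2.2.2 ξ.2.2.1 := by
  have hsub (x y z : V3 × V3) : dot2 (x - y) z = dot2 x z - dot2 y z := by
    simp only [dot2, Prod.fst_sub, Prod.snd_sub, sub_dotProduct]
    ring
  have h0 (x : V3 × V3) : dot2 x 0 = 0 := by simp [dot2]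
  have h0' (x : V3 × V3) : cross2 x 0 = 0 := by simp [cross2]
  constructor
  · intro h
    have h' (η : TrivTangent) : sigmaTriv p ξ η = (matK p.1 *ᵥ p.2.1) ⬝ᵥ η.2.1
        + dot2 (applyJ p.1 p.2.2.2) η.2.2.2 - force g p η.1 := by
      rw [← sigma_lift hp, h _ (lift_mem_tangentAt hp η), fderiv_hamiltonian g hp.1]
      rfl
    have hf0 : force g p 0 = 0 := by
      have := h' 0
      simp [sigmaTriv, h0, h0'] at this
      linarith
    refine ⟨⟨?_, ?_⟩, fun u => ?_, ?_⟩
    · rw [← sub_eq_zero]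
      refine dotProduct_self_eq_zero.1 ?_
      have := h' (0, ξ.1 - matK p.1 *ᵥ p.2.1, 0, 0)
      simp only [sigmaTriv, h0, h0', hf0, zero_dotProduct] at this
      rw [sub_dotProduct]
      linarith
    · rw [← sub_eq_zero]
      refine dot2_self_eq_zero ?_
      have := h' (0, 0, 0, ξ.2.2.1 - applyJ p.1 p.2.2.2)
      simp only [sigmaTriv, h0, h0', hf0, zero_dotProduct, dotProduct_zero] at this
      rw [hsub]
      linarith
    · have := h' (u, 0, 0, 0)
      simp only [sigmaTriv, h0, h0', dotProduct_zero] at this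
      rw [dotProduct_comm]
      linarith
    · rw [← sub_eq_zero]
      refine dot2_self_eq_zero ?_
      have := h' (0, 0, ξ.2.2.2 - cross2 p.2.2.2 ξ.2.2.1, 0)
      simp only [sigmaTriv, h0, hf0, zero_dotProduct, dotProduct_zero, dot2_cross2] at this
      rw [hsub]
      linarith
  · rintro ⟨⟨hv, hom⟩, hw, hn⟩ Y hY
    obtain ⟨η, -, rfl⟩ := (lift_bijOn hp).surjOn hY
    rw [sigma_lift hp, fderiv_hamiltonian g hp.1, sigmaTriv, dotProduct_comm η.1, hw, dot2_cross2,
      ← hn, ← hv, ← hom]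
    simp only [lift]
    ring

/-! ### Riemann's equation in components -/

/-- At a diagonal matrix `A = diag a` the projection `ℙ_A R` vanishes if and only if `R` is diagonal
and a multiple of `A⁻¹`. -/
theorem proj_diagonal_eq_zero_iff {a : V3} (ha : ∀ i, a i ≠ 0) {R : Mat3} :
    proj (Matrix.diagonal a) R = 0 ↔ (∀ i j, i ≠ j → R i j = 0) ∧
      a 0 * R 0 0 = a 2 * R 2 2 ∧ a 1 * R 1 1 = a 2 * R 2 2 := by
  have hinv : (Matrix.diagonal a)⁻¹ = Matrix.diagonal fun i => (a i)⁻¹ := by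
    refine Matrix.inv_eq_right_inv ?_
    rw [Matrix.diagonal_mul_diagonal, ← Matrix.diagonal_one]
    congr 1
    ext i
    exact mul_inv_cancel₀ (ha i)
  have htr : (R * (Matrix.diagonal a)ᵀ).trace = a 0 * R 0 0 + a 1 * R 1 1 + a 2 * R 2 2 := by
    simp [Matrix.trace, Fin.sum_univ_three]
    ring
  rw [proj, hinv, htr, Matrix.diagonal_transpose, sub_eq_zero]
  constructor
  · intro h
    have hd (i) : a i * R i i = 1 / 3 * (a 0 * R 0 0 + a 1 * R 1 1 + a 2 * R 2 2) := by
      rw [congrFun (congrFun h i) i]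
      simp [-one_div, mul_left_comm (a i), mul_inv_cancel₀ (ha i)]
    refine ⟨fun i j hij => ?_, ?_, ?_⟩
    · rw [congrFun (congrFun h i) j]
      simp [hij]
    · linarith [hd 0, hd 2]
    · linarith [hd 1, hd 2]
  · rintro ⟨h, h0, h1⟩
    have hs : 1 / 3 * (a 0 * R 0 0 + a 1 * R 1 1 + a 2 * R 2 2) = a 2 * R 2 2 := by linarith
    have hd (i) : a i * R i i = a 2 * R 2 2 := by
      fin_cases i
      exacts [h0, h1, rfl]
    rw [hs]
    ext i j
    by_cases hij : i = j
    · subst hij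
      rw [Matrix.smul_apply, Matrix.diagonal_apply_eq, smul_eq_mul, ← hd i, mul_comm (a i),
        mul_assoc, mul_inv_cancel₀ (ha i), mul_one]
    · simp [h i j hij, hij]

/-- The bracket in Riemann's equation in terms of the axes `a`, their first and second derivatives
`a'`, `a''`, the angular velocities `om` and their derivatives `om'`, and the gradient `V` of the
potential. -/
noncomputable def bracketOf (a a' a'' V : V3) (om om' : V3 × V3) : Mat3 :=
  Matrix.diagonal a''
    + (2 : ℝ) • (hat om.1 * Matrix.diagonal a' - Matrix.diagonal a' * hat om.2)
    + (hat om'.1 * Matrix.diagonal a - Matrix.diagonal a * hat om'.2)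
    + (hat om.1 ^ 2 * Matrix.diagonal a - (2 : ℝ) • (hat om.1 * Matrix.diagonal a * hat om.2)
        + Matrix.diagonal a * hat om.2 ^ 2)
    + Matrix.diagonal V

theorem diagonal_fin_three (a : V3) :
    Matrix.diagonal a = !![a 0, 0, 0; 0, a 1, 0; 0, 0, a 2] := by
  ext i j
  fin_cases i <;> fin_cases j <;> rfl

theorem bracketOf_diag_dotProduct (a a' a'' V : V3) (om om' : V3 × V3) (e : V3) :
    (bracketOf a a' a'' V om om').diag ⬝ᵥ e
      = a'' ⬝ᵥ e - (1 / 2) * dot2 (inertiaVar a e om) om + V ⬝ᵥ e := by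
  simp [bracketOf, diagonal_fin_three, hat, inertiaVar, dot2, dotProduct, Fin.sum_univ_three,
    pow_two]
  ring

/-- The equations `ṁ = m × ω` are linear combinations of the off-diagonal entries of the bracket. -/
theorem momentum_sub_cross_eq (a a' a'' V : V3) (om om' : V3 × V3) :
    inertiaVar a a' om + inertiaOf a om' - cross2 (inertiaOf a om) om
      = let R := bracketOf a a' a'' V om om'
        (![a 1 * R 2 1 - a 2 * R 1 2, a 2 * R 0 2 - a 0 * R 2 0, a 0 * R 1 0 - a 1 * R 0 1],
         ![a 1 * R 1 2 - a 2 * R 2 1, a 2 * R 2 0 - a 0 * R 0 2, a 0 * R 0 1 - a 1 * R 1 0]) := by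
  ext i <;> fin_cases i <;>
    simp [bracketOf, diagonal_fin_three, hat, inertiaVar, inertiaOf, cross2, cross_apply,
      pow_two] <;>
    ring

theorem momentum_eq_cross_iff {a : V3} (h12 : 0 < a 1 ^ 2 - a 2 ^ 2) (h02 : 0 < a 0 ^ 2 - a 2 ^ 2)
    (h01 : 0 < a 0 ^ 2 - a 1 ^ 2) (a' a'' V : V3) (om om' : V3 × V3) :
    inertiaVar a a' om + inertiaOf a om' = cross2 (inertiaOf a om) om ↔
      ∀ i j, i ≠ j → bracketOf a a' a'' V om om' i j = 0 := by
  have aux {x y p q : ℝ} (h : 0 < x ^ 2 - y ^ 2) (h1 : x * p - y * q = 0)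
      (h2 : x * q - y * p = 0) : p = 0 ∧ q = 0 := by
    have hp : (x ^ 2 - y ^ 2) * p = 0 := by linear_combination x * h1 + y * h2
    have hq : (x ^ 2 - y ^ 2) * q = 0 := by linear_combination x * h2 + y * h1
    exact ⟨(mul_eq_zero.1 hp).resolve_left h.ne', (mul_eq_zero.1 hq).resolve_left h.ne'⟩
  rw [← sub_eq_zero, momentum_sub_cross_eq a a' a'' V om om']
  generalize bracketOf a a' a'' V om om' = R
  constructor
  · intro h
    have hl := congrArg Prod.fst h
    have hr := congrArg Prod.snd h
    obtain ⟨h21, h12⟩ := aux h12 (congrFun hl 0) (congrFun hr 0)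
    obtain ⟨h20, h02⟩ := aux (p := R 2 0) (q := R 0 2) h02
      (by linarith [show a 2 * R 0 2 - a 0 * R 2 0 = 0 from congrFun hl 1])
      (by linarith [show a 2 * R 2 0 - a 0 * R 0 2 = 0 from congrFun hr 1])
    obtain ⟨h10, h01⟩ := aux h01 (congrFun hl 2) (congrFun hr 2)
    intro i j hij
    fin_cases i <;> fin_cases j <;> first | exact absurd rfl hij | assumption
  · intro h
    simp [h 0 1, h 1 0, h 0 2, h 2 0, h 1 2, h 2 1]

/-- A diagonal matrix is orthogonal to `T𝒜` if and only if it is a multiple of the inverse. -/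
theorem forall_axesDeriv_dotProduct_iff {b : V2} (hb : b ∈ setB) (r : V3) :
    (∀ u, r ⬝ᵥ axesDeriv b u = 0) ↔
      axes b 0 * r 0 = axes b 2 * r 2 ∧ axes b 1 * r 1 = axes b 2 * r 2 := by
  have h0 := (b0_pos hb).ne'
  have h1 := (b1_pos hb).ne'
  have h (u : V2) : r ⬝ᵥ axesDeriv b u = (b 0 * r 0 - b₃ b * r 2) * (u 0 / b 0)
      + (b 1 * r 1 - b₃ b * r 2) * (u 1 / b 1) := by
    simp [dotProduct, Fin.sum_univ_three, axesDeriv]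
    field_simp
    ring
  simp only [h]
  constructor
  · intro hu
    have hx := hu ![b 0, 0]
    have hy := hu ![0, b 1]
    simp [h0, h1] at hx hy
    exact ⟨sub_eq_zero.1 hx, sub_eq_zero.1 hy⟩
  · rintro ⟨hx, hy⟩ u
    rw [sub_eq_zero.2 (show b 0 * r 0 = b₃ b * r 2 from hx),
      sub_eq_zero.2 (show b 1 * r 1 = b₃ b * r 2 from hy)]
    ring

theorem hasDerivAt_leftVelocity {U : ℝ → Mat3} {om : ℝ → V3} {om' : V3} {t : ℝ}
    (hU : ∀ᶠ s in nhds t, U s ∈ SO3 ∧ HasDerivAt U (U s * hat (om s)) s)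
    (hom : HasDerivAt om om' t) :
    leftVelocity U t = hat (om t) ∧ deriv (leftVelocity U) t = hat om' := by
  have h : leftVelocity U =ᶠ[nhds t] fun s => hat (om s) :=
    hU.mono fun s hs =>
      (congrArg ((U s)ᵀ * ·) hs.2.deriv).trans (transpose_mul_mul_hat hs.1 _)
  exact ⟨h.self_of_nhds, h.deriv_eq.trans (hatL.hasFDerivAt.comp_hasDerivAt t hom).deriv⟩

theorem riemannBracket_eq (g : ℝ) {A Ul Ur : ℝ → Mat3} {β v : ℝ → V2} {om : ℝ → V3 × V3} {v' : V2}
    {om' : V3 × V3} {t : ℝ}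
    (hA : ∀ᶠ s in nhds t, A s = alpha (β s) ∧ β s 0 * β s 1 ≠ 0 ∧ HasDerivAt β (v s) s)
    (hl : ∀ᶠ s in nhds t, Ul s ∈ SO3 ∧ HasDerivAt Ul (Ul s * hat (om s).1) s)
    (hr : ∀ᶠ s in nhds t, Ur s ∈ SO3 ∧ HasDerivAt Ur (Ur s * hat (om s).2) s)
    (hv : HasDerivAt v v' t) (hom : HasDerivAt om om' t) :
    riemannBracket g A Ul Ur t = bracketOf (axes (β t)) (axesDeriv (β t) (v t))
      (axesDeriv (β t) v' + ![0, 0, b₃Hess (β t) (v t) (v t)])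
      (fun i => fderiv ℝ (potential g) (axes (β t)) (Pi.single i 1)) (om t) om' := by
  have hA' : deriv A =ᶠ[nhds t] fun s => Matrix.diagonal (axesDeriv (β s) (v s)) := by
    filter_upwards [hA, hA.eventually_nhds] with s hs hs'
    have h : A =ᶠ[nhds s] fun s => alpha (β s) := hs'.mono fun _ h => h.1
    exact h.deriv_eq.trans ((hasDerivAt_alpha hs.2.2 hs.2.1).deriv.trans (fderiv_alpha hs.2.1 _))
  obtain ⟨hAt, hbt, hβt⟩ := hA.self_of_nhds
  have hA'' : deriv (deriv A) t = Matrix.diagonal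
      (axesDeriv (β t) v' + ![0, 0, b₃Hess (β t) (v t) (v t)]) :=
    hA'.deriv_eq.trans
      (diagonalL.hasFDerivAt.comp_hasDerivAt t (hasDerivAt_axesDeriv hβt hv hbt)).deriv
  obtain ⟨hl1, hl2⟩ := hasDerivAt_leftVelocity hl hom.fst
  obtain ⟨hr1, hr2⟩ := hasDerivAt_leftVelocity hr hom.snd
  rw [riemannBracket, hA'', hl1, hl2, hr1, hr2, hA'.self_of_nhds, hAt, potentialDeriv, alpha_eq,
    Matrix.diag_diagonal]
  rfl

/-! ### Equivalence of the two systems -/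

/-- For a curve whose velocities are related to its momenta by `ḃ = 𝕂c` and `ω = 𝕁m`, Riemann's
equation for the projected curve is equivalent to Hamilton's equations for `ċ` and `ṁ`.  The
diagonal of the bracket gives the former, its off-diagonal entries give the latter; in the equation
for `ċ` the terms with the second derivative of `b₃` cancel. -/
theorem riemann_iff_hamilton (g : ℝ) {γ : ℝ → PhaseSpace} {q : ℝ → ConfSpace} {t : ℝ}
    (hq : ∀ᶠ s in nhds t, q s = config (γ s))
    (hγ : ∀ᶠ s in nhds t, γ s ∈ phaseM ∧ DifferentiableAt ℝ γ s ∧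
      (triv (γ s) (deriv γ s)).1 = matK (γ s).1 *ᵥ (γ s).2.1 ∧
      (triv (γ s) (deriv γ s)).2.2.1 = applyJ (γ s).1 (γ s).2.2.2) :
    proj (q t).1 (riemannBracket g (fun s => (q s).1) (fun s => (q s).2.1) (fun s => (q s).2.2) t)
        = 0 ↔
      (∀ u, (triv (γ t) (deriv γ t)).2.1 ⬝ᵥ u = force g (γ t) u) ∧
        (triv (γ t) (deriv γ t)).2.2.2
          = cross2 (γ t).2.2.2 (triv (γ t) (deriv γ t)).2.2.1 := by
  have hM := hγ.mono fun s hs => hs.1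
  obtain ⟨hMt, hdt, hvt, homt⟩ := hγ.self_of_nhds
  have hb := mul_ne_zero_of_mem hMt.1
  set β : ℝ → V2 := fun s => (γ s).1
  set v : ℝ → V2 := fun s => matK (γ s).1 *ᵥ (γ s).2.1
  set om : ℝ → V3 × V3 := fun s => applyJ (γ s).1 (γ s).2.2.2
  obtain ⟨v', hv⟩ : ∃ v', HasDerivAt v v' t :=
    ⟨_, (differentiableAt_matK_mulVec hMt.1).hasFDerivAt.comp_hasDerivAt t hdt.hasDerivAt⟩
  obtain ⟨om', hom⟩ : ∃ om', HasDerivAt om om' t :=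
    ⟨_, (differentiableAt_applyJ hMt.1).hasFDerivAt.comp_hasDerivAt t hdt.hasDerivAt⟩
  have hβ : ∀ᶠ s in nhds t, HasDerivAt β (v s) s := by
    filter_upwards [hγ] with s hs
    have h : HasDerivAt β (deriv γ s).1 s := hs.2.1.hasDerivAt.fst
    exact h.congr_deriv hs.2.2.1
  have hconf : ∀ᶠ s in nhds t, HasDerivAt q (configTangent (γ s) (v s) (om s)) s := by
    filter_upwards [hγ, hM.eventually_nhds, hq.eventually_nhds] with s hs hs' hqs
    have h := hasDerivAt_config hs' hs.2.1.hasDerivAt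
    exact (h.congr_of_eventuallyEq hqs).congr_deriv
      (congrArg₂ (configTangent (γ s)) hs.2.2.1 hs.2.2.2)
  have hbr := riemannBracket_eq g (A := fun s => (q s).1) (Ul := fun s => (q s).2.1)
    (Ur := fun s => (q s).2.2) (β := β) (v := v) (om := om) (t := t)
    (by
      filter_upwards [hM, hβ, hq] with s h1 h2 h3
      exact ⟨by rw [h3]; rfl, mul_ne_zero_of_mem h1.1, h2⟩)
    (by
      filter_upwards [hM, hconf, hq] with s h1 h2 h3
      exact ⟨by rw [h3]; exact h1.2.1, by
        have := h2.snd.fst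
        rw [h3]
        exact this⟩)
    (by
      filter_upwards [hM, hconf, hq] with s h1 h2 h3
      exact ⟨by rw [h3]; exact h1.2.2, by
        have := h2.snd.snd
        rw [h3]
        exact this⟩) hv hom
  have hqt : (q t).1 = Matrix.diagonal (axes (β t)) := by
    rw [hq.self_of_nhds]
    rfl
  obtain ⟨h12, h02, h01⟩ := axes_sq_sub_pos hMt.1
  have hm : ∀ᶠ s in nhds t, (γ s).2.2.2 = inertiaOf (axes (β s)) (om s) :=
    hM.mono fun s hs => (inertia_applyJ hs.1 _).symm
  have hmd : HasDerivAt (fun s => (γ s).2.2.2) (deriv γ t).2.2.2 t :=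
    hdt.hasDerivAt.snd.snd.snd
  have hmdot := hmd.unique
    ((hasDerivAt_inertiaOf (hasDerivAt_axes hβ.self_of_nhds hb) hom).congr_of_eventuallyEq hm)
  have hcdot := momentum_deriv_dotProduct hβ.self_of_nhds hdt.hasDerivAt.snd.fst hv hb
    (hM.mono fun s hs => (gram_matK_mulVec hs.1 _).symm)
  have hdiag := bracketOf_diag_dotProduct (axes (β t)) (axesDeriv (β t) (v t))
    (axesDeriv (β t) v' + ![0, 0, b₃Hess (β t) (v t) (v t)])
    (fun i => fderiv ℝ (potential g) (axes (β t)) (Pi.single i 1)) (om t) om'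
  have hoff := momentum_eq_cross_iff (a := axes (β t)) h12 h02 h01 (axesDeriv (β t) (v t))
    (axesDeriv (β t) v' + ![0, 0, b₃Hess (β t) (v t) (v t)])
    (fun i => fderiv ℝ (potential g) (axes (β t)) (Pi.single i 1)) (om t) om'
  rw [hbr, hqt, proj_diagonal_eq_zero_iff fun i => (axes_pos hMt.1 i).ne', and_comm, ← hoff]
  refine and_congr ?_ ?_
  · refine (forall_axesDeriv_dotProduct_iff hMt.1 (Matrix.diag (bracketOf _ _ _ _ _ _))).symm.trans
      (forall_congr' fun u => ?_)
    have hV : (fun i => fderiv ℝ (potential g) (axes (β t)) (Pi.single i 1)) ⬝ᵥ axesDeriv (β t) u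
        = fderiv ℝ (potential g) (axes (β t)) (axesDeriv (β t) u) := by
      conv_rhs => rw [pi_eq_sum_univ' (axesDeriv (β t) u)]
      rw [map_sum, dotProduct]
      refine Finset.sum_congr rfl fun i _ => ?_
      rw [map_smul, smul_eq_mul, mul_comm]
    have h1 : (triv (γ t) (deriv γ t)).2.1 ⬝ᵥ u = _ := hcdot u
    rw [hdiag, hV, h1, force, b₃Hess_comm (γ t).1 _ u]
    constructor <;> intro h <;> linear_combination h
  · have h1 : (triv (γ t) (deriv γ t)).2.2.2 = _ := hmdot
    rw [h1, show (triv (γ t) (deriv γ t)).2.2.1 = om t from homt, hm.self_of_nhds]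

theorem mem_tangentAt_deriv {E : Type*} [NormedAddCommGroup E] [NormedSpace ℝ E] {S : Set E}
    {I : Set ℝ} (hI : IsOpen I) {γ : ℝ → E} (hγ : ∀ t ∈ I, γ t ∈ S) {t : ℝ} (ht : t ∈ I)
    (hd : DifferentiableAt ℝ γ t) : deriv γ t ∈ tangentAt S (γ t) := by
  have hl : HasDerivAt (fun s : ℝ => t + s) 1 0 := by
    simpa using (hasDerivAt_id (0 : ℝ)).const_add t
  have hd' : HasDerivAt γ (deriv γ t) (t + 0) := by simpa using hd.hasDerivAt
  refine ⟨fun s => γ (t + s), ?_, by simp,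
    (hd'.scomp 0 hl).congr_deriv (one_smul ℝ _)⟩
  exact (hl.continuousAt.eventually_mem (hI.mem_nhds (by simpa using ht))).mono fun s hs => hγ _ hs

theorem isHamiltonianSolution_iff (g : ℝ) {I : Set ℝ} (hI : IsOpen I) {γ : ℝ → PhaseSpace} :
    IsHamiltonianSolution phaseM (hamiltonian g) sigma I γ ↔
      ∀ t ∈ I, γ t ∈ phaseM ∧ DifferentiableAt ℝ γ t ∧
        ((triv (γ t) (deriv γ t)).1 = matK (γ t).1 *ᵥ (γ t).2.1 ∧
          (triv (γ t) (deriv γ t)).2.2.1 = applyJ (γ t).1 (γ t).2.2.2) ∧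
        (∀ u, (triv (γ t) (deriv γ t)).2.1 ⬝ᵥ u = force g (γ t) u) ∧
        (triv (γ t) (deriv γ t)).2.2.2
          = cross2 (γ t).2.2.2 (triv (γ t) (deriv γ t)).2.2.1 := by
  constructor
  · intro h t ht
    obtain ⟨hM, hd, hH⟩ := h t ht
    have hlift : lift (γ t) (triv (γ t) (deriv γ t)) = deriv γ t :=
      lift_triv (mem_tangentAt_deriv hI (fun s hs => (h s hs).1) ht hd)
    refine ⟨hM, hd, (hamilton_iff g hM _).1 ?_⟩
    rwa [hlift]
  · intro h t ht
    obtain ⟨hM, hd, hH⟩ := h t ht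
    have hlift : lift (γ t) (triv (γ t) (deriv γ t)) = deriv γ t :=
      lift_triv (mem_tangentAt_deriv hI (fun s hs => (h s hs).1) ht hd)
    have h' := (hamilton_iff g hM _).2 hH
    rw [hlift] at h'
    exact ⟨hM, hd, h'⟩

theorem hamiltonian_to_riemann (g : ℝ) {I : Set ℝ} (hI : IsOpen I) {γ : ℝ → PhaseSpace}
    (hγ : IsHamiltonianSolution phaseM (hamiltonian g) sigma I γ) :
    IsRiemannSolution g I (fun t => config (γ t)) ∧
      ∀ t ∈ I, toTangent (γ t) = (config (γ t), deriv (fun s => config (γ s)) t) := by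
  rw [isHamiltonianSolution_iff g hI] at hγ
  have hq (t) (ht : t ∈ I) : HasDerivAt (fun s => config (γ s)) (toTangent (γ t)).2 t := by
    obtain ⟨-, hd, ⟨hv, hom⟩, -⟩ := hγ t ht
    refine (hasDerivAt_config ?_ hd.hasDerivAt).congr_deriv
      (congrArg₂ (configTangent (γ t)) hv hom)
    filter_upwards [hI.mem_nhds ht] with s hs using (hγ s hs).1
  refine ⟨fun t ht => ?_, fun t ht => Prod.ext rfl (hq t ht).deriv.symm⟩
  obtain ⟨hM, hd, hkin, hdyn⟩ := hγ t ht
  refine ⟨config_mem hM, (hq t ht).differentiableAt, ?_, ?_⟩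
  · have h1 : deriv (fun s => config (γ s)) =ᶠ[nhds t] fun s => (toTangent (γ s)).2 := by
      filter_upwards [hI.mem_nhds ht] with s hs using (hq s hs).deriv
    refine DifferentiableAt.congr_of_eventuallyEq ?_ h1
    have h2 : ContDiffOn ℝ ∞ toTangent {p | p.1 ∈ setB} := contDiffOn_bundleMap
      (contDiffOn_applyJ (by fun_prop) (by fun_prop) fun p hp => hp)
    have h3 : DifferentiableAt ℝ toTangent (γ t) :=
      (h2.contDiffAt (isOpen_fst_mem_setB.mem_nhds hM.1)).differentiableAt (by simp)
    exact (h3.comp t hd).snd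
  · refine (riemann_iff_hamilton g (.of_forall fun s => rfl) ?_).2 hdyn
    filter_upwards [hI.mem_nhds ht] with s hs
    exact ⟨(hγ s hs).1, (hγ s hs).2.1, (hγ s hs).2.2.1⟩

theorem SmoothOn.differentiableAt_comp {E F : Type*} [NormedAddCommGroup E] [NormedSpace ℝ E]
    [NormedAddCommGroup F] [NormedSpace ℝ F] {f : E → F} {S : Set E} (hf : SmoothOn f S)
    {c : ℝ → E} {t : ℝ} (hc : DifferentiableAt ℝ c t) (hS : ∀ᶠ s in nhds t, c s ∈ S) :
    DifferentiableAt ℝ (fun s => f (c s)) t := by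
  obtain ⟨O, hO, hpO, h, hh, heq⟩ := hf _ hS.self_of_nhds
  have h1 : DifferentiableAt ℝ h (c t) :=
    (hh.contDiffAt (hO.mem_nhds hpO)).differentiableAt (by simp)
  refine (h1.comp t hc).congr_of_eventuallyEq ?_
  filter_upwards [hS, hc.continuousAt.eventually_mem (hO.mem_nhds hpO)] with s hs hsO
  exact heq ⟨hs, hsO⟩

theorem configTangent_injective {p : PhaseSpace} (hp : p ∈ phaseM) {v w : V2} {om om' : V3 × V3}
    (h : configTangent p v om = configTangent p w om') : v = w ∧ om = om' := by
  have h1 := congrArg (fun X : ConfSpace => firstTwo X.1) h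
  have h2 := congrArg (fun X : ConfSpace => vee (p.2.2.1.1ᵀ * X.2.1)) h
  have h3 := congrArg (fun X : ConfSpace => vee (p.2.2.1.2ᵀ * X.2.2)) h
  simp only [configTangent, firstTwo_fderiv_alpha (mul_ne_zero_of_mem hp.1),
    vee_transpose_mul_mul_hat hp.2.1, vee_transpose_mul_mul_hat hp.2.2] at h1 h2 h3
  exact ⟨h1, Prod.ext h2 h3⟩

theorem riemann_to_hamiltonian (g : ℝ) {I : Set ℝ} (hI : IsOpen I) {q : ℝ → ConfSpace}
    (hq : IsRiemannSolution g I q) :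
    ∃ γ : ℝ → PhaseSpace, IsHamiltonianSolution phaseM (hamiltonian g) sigma I γ ∧
      ∀ t ∈ I, toTangent (γ t) = (q t, deriv q t) := by
  obtain ⟨-, -, h, hmaps, hsmooth, -, hright⟩ := isDiffeo_toTangent
  have hT (t) (ht : t ∈ I) : (q t, deriv q t) ∈ tangentBundle Conf :=
    ⟨(hq t ht).1, mem_tangentAt_deriv hI (fun s hs => (hq s hs).1) ht (hq t ht).2.1⟩
  have hΛ (t) (ht : t ∈ I) : toTangent (h (q t, deriv q t)) = (q t, deriv q t) := hright (hT t ht)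
  refine ⟨fun t => h (q t, deriv q t), (isHamiltonianSolution_iff g hI).2 fun t ht => ?_, hΛ⟩
  set γ : ℝ → PhaseSpace := fun t => h (q t, deriv q t) with hγ
  have hM (s) (hs : s ∈ I) : γ s ∈ phaseM := hmaps (hT s hs)
  have hconf (s) (hs : s ∈ I) : q s = config (γ s) := (congrArg Prod.fst (hΛ s hs)).symm
  have hd (s) (hs : s ∈ I) : DifferentiableAt ℝ γ s := by
    refine hsmooth.differentiableAt_comp ((hq s hs).2.1.prodMk (hq s hs).2.2.1) ?_
    filter_upwards [hI.mem_nhds hs] with r hr using hT r hr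
  have hkin (s) (hs : s ∈ I) : (triv (γ s) (deriv γ s)).1 = matK (γ s).1 *ᵥ (γ s).2.1 ∧
      (triv (γ s) (deriv γ s)).2.2.1 = applyJ (γ s).1 (γ s).2.2.2 := by
    have hev : ∀ᶠ r in nhds s, r ∈ I := hI.mem_nhds hs
    have h1 := hasDerivAt_config (hev.mono fun r hr => hM r hr) (hd s hs).hasDerivAt
    have h2 := h1.congr_of_eventuallyEq (f₁ := q) (hev.mono fun r hr => hconf r hr)
    exact configTangent_injective (hM s hs)
      (h2.deriv.symm.trans (congrArg Prod.snd (hΛ s hs)).symm)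
  refine ⟨hM t ht, hd t ht, hkin t ht, (riemann_iff_hamilton g ?_ ?_).1 (hq t ht).2.2.2⟩
  · filter_upwards [hI.mem_nhds ht] with s hs using hconf s hs
  · filter_upwards [hI.mem_nhds ht] with s hs using ⟨hM s hs, hd s hs, hkin s hs⟩

end RiemannEllipsoid



theorem proposition2 (g : ℝ) :
    -- the potential is a well-defined smooth function, and so is the Hamiltonian
    (∀ a : V3, (∀ i, 0 < a i) → MeasureTheory.IntegrableOn
      (fun s : ℝ => ((s + a 0 ^ 2) * (s + a 1 ^ 2) * (s + a 2 ^ 2)) ^ (-(1 / 2) : ℝ))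
      (Set.Ioi 0)) ∧
    ContDiffOn ℝ ∞ (potential g) {a | ∀ i, 0 < a i} ∧
    IsOpen setB ∧
    ContDiffOn ℝ ∞ (hamiltonian g) {p | p.1 ∈ setB} ∧
    -- the phase space is a manifold of dimension 16, with the left-trivialized tangent spaces
    IsSubmanifold 16 phaseM ∧
    (∀ p ∈ phaseM, Set.BijOn (lift p) Set.univ (tangentAt phaseM p)) ∧
    -- the two-form has the stated left-trivialized expression and is symplectic
    (∀ p ∈ phaseM, ∀ (v w v' w' : V2) (om n om' n' : V3 × V3),
      sigma p (lift p (v, w, om, n)) (lift p (v', w', om', n')) =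
        v ⬝ᵥ w' - v' ⬝ᵥ w + dot2 om n' - dot2 n om' + dot2 p.2.2.2 (cross2 om om')) ∧
    IsSymplecticForm 16 phaseM sigma ∧
    -- the phase space is the cotangent bundle, with its canonical symplectic form
    (∃ Φ : PhaseSpace → ConfSpace × ConfSpace,
      IsDiffeo Φ phaseM cotangentBundle ∧
      (∀ p ∈ phaseM, (Φ p).1 = config p ∧ ∀ (v : V2) (om : V3 × V3),
        pairing (Φ p).2 (configTangent p v om) = p.2.1 ⬝ᵥ v + dot2 p.2.2.2 om) ∧
      ∀ (W : Set (Fin 16 → ℝ)) (φ : (Fin 16 → ℝ) → PhaseSpace), IsOpen W →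
        ContDiffOn ℝ ∞ φ W → Set.MapsTo φ W phaseM → ∀ x ∈ W, ∀ u v,
          pullback₂ sigma φ x u v = - extD₁ (pullback₁ tautological (Φ ∘ φ)) x u v) ∧
    -- equivalence of the Hamiltonian system with Riemann's equation
    IsDiffeo toTangent phaseM (tangentBundle Conf) ∧
    (∀ I : Set ℝ, IsOpen I → ∀ γ : ℝ → PhaseSpace,
      IsHamiltonianSolution phaseM (hamiltonian g) sigma I γ →
        IsRiemannSolution g I (fun t => config (γ t)) ∧
        ∀ t ∈ I, toTangent (γ t) = (config (γ t), deriv (fun s => config (γ s)) t)) ∧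
    (∀ I : Set ℝ, IsOpen I → ∀ q : ℝ → ConfSpace, IsRiemannSolution g I q →
      ∃ γ : ℝ → PhaseSpace, IsHamiltonianSolution phaseM (hamiltonian g) sigma I γ ∧
        ∀ t ∈ I, toTangent (γ t) = (q t, deriv q t)) := by
  refine ⟨fun a ha => integrableOn_potential ha, contDiffOn_potential g, isOpen_setB,
    contDiffOn_hamiltonian g, isSubmanifold_phaseM, fun p hp => lift_bijOn hp,
    fun p hp v w v' w' om n om' n' => sigma_lift hp _ _, isSymplecticForm_sigma,
    ⟨toCotangent, isDiffeo_toCotangent, fun p hp => ⟨rfl, fun v om => pairing_toCotangent hp v om⟩,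
      fun W φ hW hφ hM x hx u v => pullback_sigma_eq_tautological hW hφ hM hx u v⟩,
    isDiffeo_toTangent, fun I hI γ hγ => hamiltonian_to_riemann g hI hγ,
    fun I hI q hq => riemann_to_hamiltonian g hI hq⟩
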